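/- **Setting.** Let $X\subset\mathbb{R}^n$ be nonempty, closed and convex; let $f_0:\mathbb{R}^n\to\mathbb{R}$ be $C^1$ and convex; let $F=(f_1,\dots,f_m):\mathbb{R}^n\to\mathbb{R}^m$ have $C^1$ components and suppose that for each $i$ there is $L_i>0$ with $\|\nabla f_i(x)-\nabla f_i(x')\|_2\le\tfrac12L_i\|x-x'\|_2$ for all $x,x'\in X$; let $h:\mathbb{R}^m\to\mathbb{R}$ be convex with $|h(z)-h(z')|\le L_h\|z-z'\|_2$ for all $z,z'\in\mathbb{R}^m$ and some $L_h>0$. Consider the problem of minimizing $f_0(x)+h(F(x))$ over $x\in X$. Let $N_X$ be the normal cone of convex analysis (empty outside $X$), $\partial$ the convex subdifferential, and $$S(x,y,z)=\{F(x)-z\}\times(\partial h(z)-y)\times\Big(\nabla f_0(x)+\sum_{i=1}^m y_i\nabla f_i(x)+N_X(x)\Big)\subset\mathbb{R}^m\times\mathbb{R}^m\times\mathbb{R}^n .$$ Distances are Euclidean and $\operatorname{dist}(0,\emptyset)=\infty$. A *lower model* of $h$ is a convex function $\mathfrak h:\mathbb{R}^m\to\mathbb{R}$ with $\mathfrak h\le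 h$. **Algorithm** (composite proximal bundle method). Data: $x_0\in X$, $\kappa\in(0,1)$, $\tau>1$, $0<\underline t<t_0<t_{\max}<\infty$, $\mathrm{Tol}\ge0$. Set $\hat x_0=x_0$, take $\hat s_0\in\partial h(F(\hat x_0))$ and a lower model $\mathfrak h_0$ of $h$. For $k=0,1,2,\dots$: 1. Compute $(x_{k+1},y_{k+1},z_{k+1})$ with $z_{k+1}=F(\hat x_k)+\nabla F(\hat x_k)(x_{k+1}-\hat x_k)$, $y_{k+1}\in\partial\mathfrak h_k(z_{k+1})$ and $-\nabla f_0(x_{k+1})-\nabla F(\hat x_k)^\top y_{k+1}-\tfrac1{t_k}(x_{k+1}-\hat x_k)\in N_X(x_{k+1})$. 2. Set $v_k=f_0(\hat x_k)+h(F(\hat x_k))-\big(f_0(x_{k+1})+\mathfrak h_k(z_{k+1})\big)$. If $v_k\le\mathrm{Tol}$, stop and return $x_{k+1}$. 3. If $f_0(x_{k+1})+h(z_{k+1})\le f_0(\hat x_k)+h(F(\hat x_k))-\kappa v_k$, then: - (serious step) if also $f_0(x_{k+1})+h(F(x_{k+1}))\le f_0(\hat x_k)+h(F(\hat x_k))-\tfrac\kappa2v_k$,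 set $\hat x_{k+1}=x_{k+1}$, choose $t_{k+1}\in[t_k,t_{\max}]$, $\hat s_{k+1}\in\partial h(F(\hat x_{k+1}))$ and a lower model $\mathfrak h_{k+1}$ of $h$ with $h(F(\hat x_{k+1}))+\langle\hat s_{k+1},z-F(\hat x_{k+1})\rangle\le\mathfrak h_{k+1}(z)$ for all $z$; - (backtracking step) otherwise set $\hat x_{k+1}=\hat x_k$, $\hat s_{k+1}=\hat s_k$, $t_{k+1}=t_k/\tau$, replace $\underline t$ by $\min\{t_k/\tau,\underline t\}$, and update the model as in ($*$). 4. (null step) If the first test in 3 fails, set $\hat x_{k+1}=\hat x_k$, $\hat s_{k+1}=\hat s_k$, choose $t_{k+1}\in[\underline t,t_k]$, and update the model as in ($*$). ($*$) Choose $s_{k+1}\in\partial h(z_{k+1})$ and a lower model $\mathfrak h_{k+1}$ of $h$ such that, for all $z$, $\mathfrak h_{k+1}(z)$ is at least each of $h(F(\hat x_k))+\langle\hat s_k,z-F(\hat x_k)\rangle$, $h(z_{k+1})+\langle s_{k+1},z-z_{k+1}\rangle$ and $\mathfrak h_k(z_{k+1})+\langle y_{k+1},z-z_{k+1}\rangle$.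 **Theorem.** Suppose that $\{x\in X: f_0(x)+h(F(x))\le f_0(x_0)+h(F(x_0))\}$ is bounded. (0) For every $\mathrm{Tol}\ge0$ the algorithm is well-defined: it can be initialized, every partial execution can be continued (until the algorithm stops, or indefinitely), and $x_{k+1}$, $z_{k+1}$, hence $v_k$, are uniquely determined by the data at the beginning of iteration $k$. (1) Let $\mathrm{Tol}=0$. Every execution either stops in some iteration $k$, and then $x^\star=\hat x_k=x_{k+1}$ satisfies $0\in S(x^\star,y^\star,F(x^\star))$ for some $y^\star\in\mathbb{R}^m$; or it continues indefinitely. In the latter case, if the models have uniformly bounded subgradients on bounded sets (for every bounded $C\subset\mathbb{R}^m$ there is $M_C>0$ with $\|y\|\le M_C$ for all $k$, $z\in C$, $y\in\partial\mathfrak h_k(z)$), then $\liminf_k v_k=0$ and every cluster point $x^\star$ of $\{\hat x_k\}$ satisfies $0\in S(x^\star,y^\star,F(x^\star))$ for some $y^\star\in\mathbb{R}^m$. (2) For the given problem and the given $x_0,\kappa,\tau,\underline t,t_0,t_{\max}$ there are numbers $\epsilon_{\mathrm{Tol}}\ge0$, $\mathrm{Tol}>0$, with $\epsilon_{\mathrm{Tol}}\to0$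 as $\mathrm{Tol}\downarrow0$, such that for every $\mathrm{Tol}>0$ every execution stops in some iteration $k_{\mathrm{Tol}}$, and its last iterate $x_{\mathrm{Tol}}=x_{k_{\mathrm{Tol}}+1}$ satisfies $\operatorname{dist}\big(0,S(x_{\mathrm{Tol}},y^\star,z^\star)\big)\le\epsilon_{\mathrm{Tol}}$ for some $y^\star,z^\star\in\mathbb{R}^m$. -/

import Mathlib

open scoped Pointwise

namespace CompositeBundle

/-- `ℝⁿ` with the Euclidean norm. -/
abbrev E (n : ℕ) : Type := EuclideanSpace ℝ (Fin n)

/-! ### Convex analysis -/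

/-- The subdifferential of a real-valued convex function `g` at `z`. -/
def subdiff {m : ℕ} (g : E m → ℝ) (z : E m) : Set (E m) :=
  {y | ∀ w : E m, g z + inner ℝ y (w - z) ≤ g w}

/-- The normal cone to a convex set `X` at `x`; it is empty when `x ∉ X`. -/
def normalCone {n : ℕ} (X : Set (E n)) (x : E n) : Set (E n) :=
  {v | x ∈ X ∧ ∀ x' ∈ X, inner ℝ v (x' - x) ≤ 0}

/-- `g` is a lower model of `h`: a convex real-valued minorant. -/
def IsLowerModel {m : ℕ} (h g : E m → ℝ) : Prop :=
  ConvexOn ℝ Set.univ g ∧ ∀ z, g z ≤ h z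

/-- The affine function `z ↦ c + ⟨s, z - z₀⟩` is a minorant of `g`. -/
def Minorizes {m : ℕ} (c : ℝ) (s z₀ : E m) (g : E m → ℝ) : Prop :=
  ∀ z : E m, c + inner ℝ s (z - z₀) ≤ g z

/-! ### The composite problem: minimize `f₀ x + h (F x)` over `x ∈ X` -/

structure Problem (n m : ℕ) where
  X : Set (E n)
  f₀ : E n → ℝ
  F : E n → E m
  h : E m → ℝ

namespace Problem

variable {n m : ℕ}

/-- The objective function. -/
def obj (P : Problem n m) (x : E n) : ℝ := P.f₀ x + P.h (P.F x)

/-- The `i`-th component function of `F`. -/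
def comp (P : Problem n m) (i : Fin m) (x : E n) : ℝ := P.F x i

/-- The standing assumptions on the data of the problem. -/
structure Assumptions (P : Problem n m) : Prop where
  nonempty_X : P.X.Nonempty
  closed_X : IsClosed P.X
  convex_X : Convex ℝ P.X
  smooth_f₀ : ContDiff ℝ 1 P.f₀
  convex_f₀ : ConvexOn ℝ Set.univ P.f₀
  smooth_F : ∀ i : Fin m, ContDiff ℝ 1 (P.comp i)
  lipschitz_grad : ∀ i : Fin m, ∃ L : ℝ, 0 < L ∧ ∀ x ∈ P.X, ∀ x' ∈ P.X,
    ‖gradient (P.comp i) x - gradient (P.comp i) x'‖ ≤ 1 / 2 * L * ‖x - x'‖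
  convex_h : ConvexOn ℝ Set.univ P.h
  lipschitz_h : ∃ L : ℝ, 0 < L ∧ ∀ z z' : E m, |P.h z - P.h z'| ≤ L * ‖z - z'‖

/-- The problem is level-bounded for `x₀`. -/
def LevelBounded (P : Problem n m) (x₀ : E n) : Prop :=
  Bornology.IsBounded {x | x ∈ P.X ∧ P.obj x ≤ P.obj x₀}

/-- The set-valued mapping of first-order information on the component functions. For smooth
component functions it is `Dᵢ(x) = {∇fᵢ(x)}`. -/
def D (P : Problem n m) (i : Fin m) (x : E n) : Set (E n) := {gradient (P.comp i) x}

/-- The set-valued mapping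
`S(x,y,z) = {F(x) - z} × (∂h(z) - y) × (∇f₀(x) + ∑ᵢ yᵢ con Dᵢ(x) + N_X(x))`,
as a subset of the product space with its Euclidean norm. -/
def S (P : Problem n m) (x : E n) (y z : E m) :
    Set (WithLp 2 (E m × WithLp 2 (E m × E n))) :=
  {w | w.fst ∈ ({P.F x - z} : Set (E m)) ∧
    w.snd.fst ∈ subdiff P.h z - ({y} : Set (E m)) ∧
    w.snd.snd ∈ ({gradient P.f₀ x} : Set (E n))
      + ∑ i : Fin m, y i • convexHull ℝ (P.D i x) + normalCone P.X x}

end Problem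

/-! ### The composite proximal bundle method -/

/-- The parameters of the algorithm (apart from the tolerance); `tlow` is the initial value of
the lower threshold `t̲` for the prox-parameters. -/
structure Params (n : ℕ) where
  x₀ : E n
  κ : ℝ
  τ : ℝ
  tlow : ℝ
  t₀ : ℝ
  tmax : ℝ

structure Params.Valid {n m : ℕ} (A : Params n) (P : Problem n m) : Prop where
  x₀_mem : A.x₀ ∈ P.X
  κ_pos : 0 < A.κ
  κ_lt : A.κ < 1
  one_lt_τ : 1 < A.τ
  tlow_pos : 0 < A.tlow
  tlow_lt : A.tlow < A.t₀
  t₀_lt : A.t₀ < A.tmax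

/-- What the algorithm holds at the beginning of iteration `k`: the stability center `x̂ₖ`, the
subgradient `ŝₖ ∈ ∂h(F(x̂ₖ))`, the prox-parameter `tₖ`, the current value of the threshold `t̲`,
and the model `𝔥ₖ`. -/
structure State (n m : ℕ) where
  center : E n
  slope : E m
  t : ℝ
  tlow : ℝ
  model : E m → ℝ

/-- The triple `(xₖ₊₁, yₖ₊₁, zₖ₊₁)` computed in iteration `k`. -/
structure Trial (n m : ℕ) where
  x : E n
  y : E m
  z : E m

section Algorithm

variable {n m : ℕ}

/-- Initialization. -/
structure IsInit (P : Problem n m) (A : Params n) (s : State n m) : Prop where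
  center_eq : s.center = A.x₀
  slope_mem : s.slope ∈ subdiff P.h (P.F s.center)
  t_eq : s.t = A.t₀
  tlow_eq : s.tlow = A.tlow
  lower : IsLowerModel P.h s.model

/-- The optimality conditions of the master problem. -/
structure IsTrial (P : Problem n m) (s : State n m) (T : Trial n m) : Prop where
  z_eq : T.z = P.F s.center + fderiv ℝ P.F s.center (T.x - s.center)
  y_mem : T.y ∈ subdiff s.model T.z
  x_opt : -gradient P.f₀ T.x - (ContinuousLinearMap.adjoint (fderiv ℝ P.F s.center)) T.y
      - (1 / s.t) • (T.x - s.center) ∈ normalCone P.X T.x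

/-- The predicted decrease `vₖ`. -/
def predDecrease (P : Problem n m) (s : State n m) (T : Trial n m) : ℝ :=
  P.f₀ s.center + P.h (P.F s.center) - (P.f₀ T.x + s.model T.z)

/-- The first descent test, on the linearized problem. -/
def Test₁ (P : Problem n m) (A : Params n) (s : State n m) (T : Trial n m) : Prop :=
  P.f₀ T.x + P.h T.z ≤ P.f₀ s.center + P.h (P.F s.center) - A.κ * predDecrease P s T

/-- The second descent test, on the actual problem. -/
def Test₂ (P : Problem n m) (A : Params n) (s : State n m) (T : Trial n m) : Prop :=
  P.f₀ T.x + P.h (P.F T.x) ≤ P.f₀ s.center + P.h (P.F s.center) - A.κ / 2 * predDecrease P s T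

/-- The update of the state in a serious step. -/
structure SeriousStep (P : Problem n m) (A : Params n) (s : State n m) (T : Trial n m)
    (s' : State n m) : Prop where
  center_eq : s'.center = T.x
  t_mem : s'.t ∈ Set.Icc s.t A.tmax
  tlow_eq : s'.tlow = s.tlow
  slope_mem : s'.slope ∈ subdiff P.h (P.F s'.center)
  lower : IsLowerModel P.h s'.model
  minorizes : Minorizes (P.h (P.F s'.center)) s'.slope (P.F s'.center) s'.model

/-- The requirement on the new model in backtracking and null steps: it is a lower model above
three linearizations. -/
def ModelUpdate (P : Problem n m) (s : State n m) (T : Trial n m) (s' : State n m) : Prop :=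
  IsLowerModel P.h s'.model ∧
  Minorizes (P.h (P.F s.center)) s.slope (P.F s.center) s'.model ∧
  (∃ g ∈ subdiff P.h T.z, Minorizes (P.h T.z) g T.z s'.model) ∧
  Minorizes (s.model T.z) T.y T.z s'.model

/-- The update of the state in a backtracking step. -/
structure BacktrackingStep (P : Problem n m) (A : Params n) (s : State n m) (T : Trial n m)
    (s' : State n m) : Prop where
  center_eq : s'.center = s.center
  slope_eq : s'.slope = s.slope
  t_eq : s'.t = s.t / A.τ
  tlow_eq : s'.tlow = min (s.t / A.τ) s.tlow
  model : ModelUpdate P s T s'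

/-- The update of the state in a null step. -/
structure NullStep (P : Problem n m) (s : State n m) (T : Trial n m) (s' : State n m) : Prop where
  center_eq : s'.center = s.center
  slope_eq : s'.slope = s.slope
  t_mem : s'.t ∈ Set.Icc s.tlow s.t
  tlow_eq : s'.tlow = s.tlow
  model : ModelUpdate P s T s'

/-- The update of the state at the end of an iteration that does not stop. -/
def Update (P : Problem n m) (A : Params n) (s : State n m) (T : Trial n m)
    (s' : State n m) : Prop :=
  (Test₁ P A s T → Test₂ P A s T → SeriousStep P A s T s') ∧
  (Test₁ P A s T → ¬ Test₂ P A s T → BacktrackingStep P A s T s') ∧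
  (¬ Test₁ P A s T → NullStep P s T s')

end Algorithm

/-- A record of an execution: `state k` and `trial k` belong to iteration `k`. The entries after
the algorithm has stopped carry no meaning and are not constrained. -/
structure Run (n m : ℕ) where
  state : ℕ → State n m
  trial : ℕ → Trial n m

namespace Run

variable {n m : ℕ}

/-- The stability center `x̂ₖ`. -/
def center (r : Run n m) (k : ℕ) : E n := (r.state k).center

/-- The point `xₖ₊₁` computed in iteration `k`. -/
def next (r : Run n m) (k : ℕ) : E n := (r.trial k).x

/-- The predicted decrease `vₖ`. -/
def v (P : Problem n m) (r : Run n m) (k : ℕ) : ℝ := predDecrease P (r.state k) (r.trial k)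

/-- Iteration `k` is carried out: the algorithm has not stopped before. -/
def Active (P : Problem n m) (Tol : ℝ) (r : Run n m) (k : ℕ) : Prop :=
  ∀ j < k, Tol < r.v P j

/-- The algorithm stops in iteration `k` (and returns `xₖ₊₁`). -/
def StopsAt (P : Problem n m) (Tol : ℝ) (r : Run n m) (k : ℕ) : Prop :=
  r.Active P Tol k ∧ r.v P k ≤ Tol

/-- If iteration `k` is carried out, then it follows the rules of the algorithm. -/
def Obeys (P : Problem n m) (A : Params n) (Tol : ℝ) (r : Run n m) (k : ℕ) : Prop :=
  r.Active P Tol k →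
    IsTrial P (r.state k) (r.trial k) ∧
    (Tol < r.v P k → Update P A (r.state k) (r.trial k) (r.state (k + 1)))

/-- `r` records the initialization and the iterations `0, …, K - 1` of the algorithm. -/
def IsPartial (P : Problem n m) (A : Params n) (Tol : ℝ) (K : ℕ) (r : Run n m) : Prop :=
  IsInit P A (r.state 0) ∧ ∀ k < K, r.Obeys P A Tol k

/-- `r` records a complete execution of the algorithm, finite or infinite. -/
def IsExecution (P : Problem n m) (A : Params n) (Tol : ℝ) (r : Run n m) : Prop :=
  IsInit P A (r.state 0) ∧ ∀ k, r.Obeys P A Tol k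

/-- The models have uniformly bounded subgradients on bounded sets. -/
def BoundedSubgradients (P : Problem n m) (Tol : ℝ) (r : Run n m) : Prop :=
  ∀ C : Set (E m), Bornology.IsBounded C → ∃ M : ℝ, 0 < M ∧
    ∀ k, r.Active P Tol k → ∀ z ∈ C, ∀ y ∈ subdiff (r.state k).model z, ‖y‖ ≤ M

end Run

/-- The algorithm is well-defined: it can be initialized, the points `xₖ₊₁` and `zₖ₊₁` are
determined by the data at the beginning of iteration `k`, and every partial execution can be
continued to a complete one. -/
def WellDefined {n m : ℕ} (P : Problem n m) (A : Params n) (Tol : ℝ) : Prop :=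
  (∃ s : State n m, IsInit P A s) ∧
  (∀ r : Run n m, r.IsExecution P A Tol → ∀ k, r.Active P Tol k →
    ∀ T : Trial n m, IsTrial P (r.state k) T →
      T.x = (r.trial k).x ∧ T.z = (r.trial k).z) ∧
  (∀ (K : ℕ) (r : Run n m), r.IsPartial P A Tol K →
    ∃ r' : Run n m, r'.IsExecution P A Tol ∧
      (∀ k ≤ K, r'.state k = r.state k) ∧ (∀ k < K, r'.trial k = r.trial k))

end CompositeBundle

/-! Everything rests on the quadratic growth of the master problem around its solution
(`IsTrial.growth`). Comparing with the stability center gives `IsTrial.le_predDecrease`: the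
predicted decrease v dominates the sum of two nonnegative quantities, ‖xₖ₊₁ - x̂ₖ‖² / tₖ and the
error with which yₖ₊₁ is an approximate subgradient of h at F(x̂ₖ). So a small v means a short step
and an almost exact subgradient. A proximal step on h (`exists_mem_subdiff_near`) turns the latter
into an exact subgradient at a point √v away, and `IsTrial.approx_stationary` bounds the
stationarity residual by a continuous function of v that vanishes at 0. Its constants depend only on
the problem and the parameters: convex minorants of h inherit its Lipschitz constant, which bounds
all model subgradients, and backtracking never pushes tₖ below a fixed `tmin`.

It remains to make v small along an infinite execution (`exists_small`). With infinitely many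
serious steps, the objective decreases by at least κv/2 at each of them while bounded below.
Otherwise, since tₖ ≥ `tmin`, only null steps remain eventually. Then the optimal values of the
master problems increase and stay below the objective at the center, so consecutive trial points
approach each other by quadratic growth; the cut added at the last trial point gives v' ≤ κv + C‖x'
- x‖, and v contracts.

Well-definedness needs solvability of the optimality system of the master problem. It is obtained by
penalizing the coupling z = F(x̂) + F'(x̂)(x - x̂): the penalty terms produce multipliers that are
subgradients, hence bounded, and a limit along a subsequence solves the system (`exists_master`). -/

namespace CompositeBundle

open Filter Topology

/-! ### Convex analysis: subgradients and solvability of the master problem. -/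

section ConvexAnalysis

/-- First-order optimality condition for the sum of a differentiable and a convex function. -/
theorem le_add_of_isMinOn_add {V : Type*} [NormedAddCommGroup V] [NormedSpace ℝ V]
    {C : Set V} {φ g : V → ℝ} {φ' : V →L[ℝ] ℝ} {x x' : V} (hφ : HasFDerivAt φ φ' x)
    (hC : Convex ℝ C) (hg : ConvexOn ℝ Set.univ g) (hmin : IsMinOn (fun u => φ u + g u) C x)
    (hx : x ∈ C) (hx' : x' ∈ C) : g x ≤ φ' (x' - x) + g x' := by
  -- On the segment from x to x', convexity replaces g by its chord, so that only φ has to be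
  -- differentiated at s = 0.
  have hd : HasDerivAt (fun s : ℝ => φ (x + s • (x' - x)) + s * (g x' - g x))
      (φ' (x' - x) + (g x' - g x)) 0 := by
    have h1 : HasDerivAt (fun s : ℝ => x + s • (x' - x)) (x' - x) 0 := by
      simpa using ((hasDerivAt_id (0 : ℝ)).smul_const (x' - x)).const_add x
    have h2 : HasDerivAt (fun s : ℝ => φ (x + s • (x' - x))) (φ' (x' - x)) 0 := by
      have : HasFDerivAt φ φ' (x + (0 : ℝ) • (x' - x)) := by simpa using hφ
      exact this.comp_hasDerivAt (0 : ℝ) h1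
    have h3 : HasDerivAt (fun s : ℝ => s * (g x' - g x)) (g x' - g x) 0 := by
      simpa using (hasDerivAt_id (0 : ℝ)).mul_const (g x' - g x)
    exact h2.add h3
  have hs := hd.tendsto_slope_zero_right
  have h0 : 0 ≤ φ' (x' - x) + (g x' - g x) := by
    refine ge_of_tendsto hs ?_
    have : Set.Ioo (0 : ℝ) 1 ∈ 𝓝[>] (0 : ℝ) := Ioo_mem_nhdsGT one_pos
    filter_upwards [this] with s hs
    have hmem : x + s • (x' - x) ∈ C := hC.add_smul_sub_mem hx hx' ⟨hs.1.le, hs.2.le⟩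
    have h1 := isMinOn_iff.1 hmin _ hmem
    have h2 := hg.2 (Set.mem_univ x) (Set.mem_univ x') (sub_nonneg.2 hs.2.le) hs.1.le
      (by ring : (1 - s) + s = 1)
    have h3 : (1 - s) • x + s • x' = x + s • (x' - x) := by module
    rw [h3] at h2
    simp only [smul_eq_mul] at h2 ⊢
    refine mul_nonneg (inv_nonneg.2 hs.1.le) ?_
    simp only [zero_add, zero_smul, add_zero, zero_mul]
    nlinarith
  linarith

variable {n m : ℕ}

theorem fderiv_eq_inner_gradient {f : E n → ℝ} {x : E n} (hf : DifferentiableAt ℝ f x) (v : E n) :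
    fderiv ℝ f x v = inner ℝ (gradient f x) v := by
  rw [hf.hasGradientAt.hasFDerivAt.fderiv]
  simp

theorem gradient_mem_subdiff {f : E n → ℝ} (hf : Differentiable ℝ f)
    (hconv : ConvexOn ℝ Set.univ f) (x : E n) : gradient f x ∈ subdiff f x := by
  intro w
  -- With φ = -f and g = f the sum vanishes identically, so every point is a minimizer and the
  -- optimality condition is the gradient inequality.
  have h := le_add_of_isMinOn_add (C := Set.univ) (φ := fun u => -f u) (g := f) (x := x) (x' := w)
    (hf x).hasFDerivAt.neg convex_univ hconv (by intro u _; simp) trivial trivial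
  have h2 := fderiv_eq_inner_gradient (hf x) (w - x)
  simp only [neg_apply] at h
  linarith

theorem inner_sub_nonneg_of_mem_subdiff {g : E m → ℝ} {z z' y y' : E m} (hy : y ∈ subdiff g z)
    (hy' : y' ∈ subdiff g z') : 0 ≤ inner ℝ (y - y') (z - z') := by
  have h1 := hy z'
  have h2 := hy' z
  have h3 : inner ℝ y (z' - z) = -inner ℝ y (z - z') := by
    rw [← inner_neg_right, neg_sub]
  rw [inner_sub_left]
  linarith

theorem continuous_gradient {f : E n → ℝ} (hf : ContDiff ℝ 1 f) : Continuous (gradient f) :=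
  (LinearIsometryEquiv.continuous _).comp (hf.continuous_fderiv one_ne_zero)

/-- A convex minorant of a Lipschitz function is Lipschitz with the same constant. -/
theorem IsLowerModel.sub_le {h g : E m → ℝ} (hg : IsLowerModel h g) {L : ℝ}
    (hL : ∀ z z' : E m, |h z - h z'| ≤ L * ‖z - z'‖) (a b : E m) :
    g b - g a ≤ L * ‖b - a‖ := by
  -- The point b is a convex combination of a and the remote point a + s(b - a), where g ≤ h grows
  -- at rate at most L. The contribution of h a - g a fades as s → ∞.
  have key : ∀ s : ℝ, 1 ≤ s → g b - g a ≤ (h a - g a) / s + L * ‖b - a‖ := by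
    intro s hs
    have hs0 : 0 < s := by linarith
    have h1 := hg.1.2 (Set.mem_univ a) (Set.mem_univ (a + s • (b - a)))
      (sub_nonneg.2 (inv_le_one_of_one_le₀ hs)) (inv_nonneg.2 hs0.le)
      (by ring : (1 - s⁻¹) + s⁻¹ = 1)
    have h2 : (1 - s⁻¹) • a + s⁻¹ • (a + s • (b - a)) = b := by
      rw [smul_add, smul_smul, inv_mul_cancel₀ hs0.ne']; module
    rw [h2] at h1
    simp only [smul_eq_mul] at h1
    have h3 := hg.2 (a + s • (b - a))
    have h4 := (abs_le.1 (hL (a + s • (b - a)) a)).2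
    rw [add_sub_cancel_left, norm_smul, Real.norm_of_nonneg hs0.le] at h4
    have h5 : s⁻¹ * g (a + s • (b - a)) ≤ s⁻¹ * (h a + L * (s * ‖b - a‖)) :=
      mul_le_mul_of_nonneg_left (by linarith) (inv_nonneg.2 hs0.le)
    have h6 : s⁻¹ * (h a + L * (s * ‖b - a‖)) = h a / s + L * ‖b - a‖ := by
      field_simp
    have h7 : (h a - g a) / s = h a / s - s⁻¹ * g a := by ring
    linarith
  have hlim : Tendsto (fun s : ℝ => (h a - g a) / s + L * ‖b - a‖) atTop
      (𝓝 (0 + L * ‖b - a‖)) :=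
    (tendsto_const_nhds.div_atTop tendsto_id).add_const _
  rw [zero_add] at hlim
  exact ge_of_tendsto hlim (eventually_atTop.2 ⟨1, key⟩)

theorem continuous_of_sub_le {g : E m → ℝ} {L : ℝ} (hL : ∀ a b : E m, g b - g a ≤ L * ‖b - a‖) :
    Continuous g := by
  have : LipschitzWith L.toNNReal g := by
    refine LipschitzWith.of_dist_le_mul fun a b => ?_
    rw [Real.dist_eq, dist_eq_norm]
    have h1 := hL a b
    have h2 := hL b a
    rw [norm_sub_rev] at h1
    calc |g a - g b| ≤ L * ‖a - b‖ := abs_le.2 ⟨by linarith, h2⟩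
      _ ≤ _ := mul_le_mul_of_nonneg_right (Real.le_coe_toNNReal L) (norm_nonneg _)
  exact this.continuous

/-- Testing the subgradient inequality at z + y gives ‖y‖² ≤ L‖y‖. -/
theorem norm_le_of_mem_subdiff {g : E m → ℝ} {L : ℝ} (hL0 : 0 ≤ L)
    (hL : ∀ a b : E m, g b - g a ≤ L * ‖b - a‖) {z y : E m} (hy : y ∈ subdiff g z) : ‖y‖ ≤ L := by
  have h1 := hy (z + y)
  have h2 := hL z (z + y)
  rw [add_sub_cancel_left] at h1 h2
  rw [real_inner_self_eq_norm_sq] at h1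
  by_contra! hlt
  nlinarith [norm_nonneg y]

theorem mem_subdiff_of_tendsto {ι : Type*} {l : Filter ι} [l.NeBot] {g : E m → ℝ}
    (hg : Continuous g) {y z : ι → E m} {y₀ z₀ : E m} (hy : Tendsto y l (𝓝 y₀))
    (hz : Tendsto z l (𝓝 z₀)) (h : ∀ i, y i ∈ subdiff g (z i)) : y₀ ∈ subdiff g z₀ := by
  intro w
  have : Tendsto (fun i => g (z i) + inner ℝ (y i) (w - z i)) l
      (𝓝 (g z₀ + inner ℝ y₀ (w - z₀))) :=
    ((hg.tendsto _).comp hz).add (hy.inner (tendsto_const_nhds.sub hz))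
  exact le_of_tendsto this (Eventually.of_forall fun i => h i w)

theorem mem_normalCone_of_tendsto {ι : Type*} {l : Filter ι} [l.NeBot] {X : Set (E n)}
    (hX : IsClosed X) {v x : ι → E n} {v₀ x₀ : E n} (hv : Tendsto v l (𝓝 v₀))
    (hx : Tendsto x l (𝓝 x₀)) (h : ∀ i, v i ∈ normalCone X (x i)) : v₀ ∈ normalCone X x₀ := by
  refine ⟨hX.mem_of_tendsto hx (Eventually.of_forall fun i => (h i).1), fun x' hx' => ?_⟩
  exact le_of_tendsto (hv.inner (tendsto_const_nhds.sub hx))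
    (Eventually.of_forall fun i => (h i).2 x' hx')

/-- A quadratically penalized version of the master problem has a solution. -/
theorem exists_penalized {X : Set (E n)} (hX : X.Nonempty) (hXc : IsClosed X)
    (hXconv : Convex ℝ X) {f : E n → ℝ} (hf : ContDiff ℝ 1 f) (hfconv : ConvexOn ℝ Set.univ f)
    {g : E m → ℝ} (hg : ConvexOn ℝ Set.univ g) {L : ℝ} (hL0 : 0 ≤ L)
    (hL : ∀ a b : E m, g b - g a ≤ L * ‖b - a‖) (B : E n →L[ℝ] E m) (b : E m) (c : E n) {t ρ : ℝ}
    (ht : 0 < t) (hρ : 0 < ρ) :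
    ∃ (x : E n) (w : E m), ρ • (b + B (x - c) - w) ∈ subdiff g w ∧
      -gradient f x - ContinuousLinearMap.adjoint B (ρ • (b + B (x - c) - w))
        - (1 / t) • (x - c) ∈ normalCone X x := by
  have hfd : Differentiable ℝ f := hf.differentiable one_ne_zero
  have hgcont := continuous_of_sub_le hL
  let q : E n → E m → ℝ := fun x w =>
    ρ / 2 * ‖b + B (x - c) - w‖ ^ 2 + 1 / (2 * t) * ‖x - c‖ ^ 2
  let Φ : E n × E m → ℝ := fun p => f p.1 + g p.2 + q p.1 p.2
  have hΦ : Continuous Φ := by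
    have := hf.continuous
    fun_prop
  obtain ⟨x₀, hx₀⟩ := hX
  let K : Set (E n × E m) := {p | p.1 ∈ X ∧ Φ p ≤ Φ (x₀, b)}
  have hKclosed : IsClosed K :=
    (hXc.preimage continuous_fst).inter (isClosed_le hΦ continuous_const)
  -- Coercivity: f and g decrease at most linearly, with total loss a·d + L·u. Young's inequality
  -- with slopes a + 1 and L + 1 lets the quadratic terms absorb this loss and leaves d + u bounded.
  have hbd : ∃ R, ∀ p ∈ K, ‖p.1 - c‖ ≤ R ∧ ‖b + B (p.1 - c) - p.2‖ ≤ R := by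
    set a := ‖gradient f c‖ + L * ‖B‖ with ha
    refine ⟨Φ (x₀, b) - f c - g b + t * (a + 1) ^ 2 / 2 + (L + 1) ^ 2 / (2 * ρ), fun p hp => ?_⟩
    have h1 := gradient_mem_subdiff hfd hfconv c p.1
    have h2 := hL p.2 b
    have h3 : -(‖gradient f c‖ * ‖p.1 - c‖) ≤ inner ℝ (gradient f c) (p.1 - c) :=
      neg_le_of_abs_le (abs_real_inner_le_norm _ _)
    have h4 : ‖b - p.2‖ ≤ ‖b + B (p.1 - c) - p.2‖ + ‖B‖ * ‖p.1 - c‖ := by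
      have : b - p.2 = (b + B (p.1 - c) - p.2) - B (p.1 - c) := by abel
      rw [this]
      exact (norm_sub_le _ _).trans (add_le_add_right (B.le_opNorm _) _)
    have h4' := mul_le_mul_of_nonneg_left h4 hL0
    have h5 : f p.1 + g p.2 + (ρ / 2 * ‖b + B (p.1 - c) - p.2‖ ^ 2
      + 1 / (2 * t) * ‖p.1 - c‖ ^ 2) ≤ Φ (x₀, b) := hp.2
    set d := ‖p.1 - c‖
    set u := ‖b + B (p.1 - c) - p.2‖
    have hd : 0 ≤ d := norm_nonneg _
    have hu : 0 ≤ u := norm_nonneg _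
    have h6 : (a + 1) * d - t * (a + 1) ^ 2 / 2 ≤ 1 / (2 * t) * d ^ 2 := by
      have : 1 / (2 * t) * d ^ 2 - ((a + 1) * d - t * (a + 1) ^ 2 / 2)
          = 1 / (2 * t) * (d - t * (a + 1)) ^ 2 := by field_simp; ring
      have : 0 ≤ 1 / (2 * t) * (d - t * (a + 1)) ^ 2 := by positivity
      linarith
    have h7 : (L + 1) * u - (L + 1) ^ 2 / (2 * ρ) ≤ ρ / 2 * u ^ 2 := by
      have : ρ / 2 * u ^ 2 - ((L + 1) * u - (L + 1) ^ 2 / (2 * ρ))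
          = 1 / (2 * ρ) * (ρ * u - (L + 1)) ^ 2 := by field_simp; ring
      have : 0 ≤ 1 / (2 * ρ) * (ρ * u - (L + 1)) ^ 2 := by positivity
      linarith
    have h8 : a * d = ‖gradient f c‖ * d + L * (‖B‖ * d) := by rw [ha]; ring
    constructor <;> linarith
  obtain ⟨R, hR⟩ := hbd
  have hKcomp : IsCompact K := by
    refine ((isCompact_closedBall c R).prod
      (isCompact_closedBall b (R + ‖B‖ * R))).of_isClosed_subset hKclosed fun p hp => ?_
    obtain ⟨h1, h2⟩ := hR p hp
    refine ⟨by simpa [dist_eq_norm] using h1, ?_⟩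
    rw [Metric.mem_closedBall, dist_eq_norm]
    have : p.2 - b = B (p.1 - c) - (b + B (p.1 - c) - p.2) := by abel
    rw [this]
    have h3 : ‖B (p.1 - c)‖ ≤ ‖B‖ * R := (B.le_opNorm _).trans (by gcongr)
    linarith [norm_sub_le (B (p.1 - c)) (b + B (p.1 - c) - p.2)]
  obtain ⟨⟨x, w⟩, hxw, hmin⟩ := hKcomp.exists_isMinOn ⟨(x₀, b), hx₀, le_rfl⟩ hΦ.continuousOn
  have hminX : ∀ x' ∈ X, ∀ w', Φ (x, w) ≤ Φ (x', w') := by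
    intro x' hx' w'
    by_cases hle : Φ (x', w') ≤ Φ (x₀, b)
    · exact hmin (show (x', w') ∈ K from ⟨hx', hle⟩)
    · exact hxw.2.trans (not_le.1 hle).le
  refine ⟨x, w, fun w' => ?_, hxw.1, fun x' hx' => ?_⟩
  · have hder : HasFDerivAt (fun u : E m => ρ / 2 * ‖b + B (x - c) - u‖ ^ 2)
        ((ρ / 2) • (2 • (innerSL ℝ (b + B (x - c) - w)).comp (-ContinuousLinearMap.id ℝ (E m)))) w :=
      (((hasFDerivAt_id w).const_sub (b + B (x - c))).norm_sq).const_mul (ρ / 2)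
    have h := le_add_of_isMinOn_add (C := Set.univ) (x' := w') hder convex_univ hg
      (isMinOn_iff.2 fun u _ => by
        have := hminX x hxw.1 u
        simp only [Φ, q] at this
        linarith) trivial trivial
    have e : ((ρ / 2) • (2 • (innerSL ℝ (b + B (x - c) - w)).comp
        (-ContinuousLinearMap.id ℝ (E m)))) (w' - w)
        = - inner ℝ (ρ • (b + B (x - c) - w)) (w' - w) := by
      simp only [smul_apply, ContinuousLinearMap.comp_apply, neg_apply,
        ContinuousLinearMap.id_apply, innerSL_apply_apply, inner_neg_right,
        real_inner_smul_left, smul_eq_mul, nsmul_eq_mul]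
      push_cast
      ring
    rw [e] at h
    linarith
  · have hder : HasFDerivAt (fun u : E n => ρ / 2 * ‖b + B (u - c) - w‖ ^ 2
          + 1 / (2 * t) * ‖u - c‖ ^ 2)
        ((ρ / 2) • (2 • (innerSL ℝ (b + B (x - c) - w)).comp
          (B.comp (ContinuousLinearMap.id ℝ (E n))))
          + (1 / (2 * t)) • (2 • (innerSL ℝ (x - c)).comp (ContinuousLinearMap.id ℝ (E n)))) x := by
      have h0 := (hasFDerivAt_id (𝕜 := ℝ) x).sub_const c
      have h1 := ((B.hasFDerivAt.comp x h0).const_add b).sub_const w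
      exact (h1.norm_sq.const_mul (ρ / 2)).add (h0.norm_sq.const_mul (1 / (2 * t)))
    have h := le_add_of_isMinOn_add (x' := x') (g := fun _ => 0) (C := X)
      ((hfd x).hasFDerivAt.add hder) hXconv (convexOn_const 0 convex_univ)
      (isMinOn_iff.2 fun u hu => by
        have := hminX u hu w
        simp only [Φ, q, Pi.add_apply] at this ⊢
        linarith) hxw.1 hx'
    have e : ((ρ / 2) • (2 • (innerSL ℝ (b + B (x - c) - w)).comp
          (B.comp (ContinuousLinearMap.id ℝ (E n))))
          + (1 / (2 * t)) • (2 • (innerSL ℝ (x - c)).comp (ContinuousLinearMap.id ℝ (E n)))) (x' - x)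
        = inner ℝ (ρ • (b + B (x - c) - w)) (B (x' - x)) + inner ℝ ((1 / t) • (x - c)) (x' - x) := by
      simp only [add_apply, smul_apply,
        ContinuousLinearMap.comp_apply, ContinuousLinearMap.id_apply, innerSL_apply_apply,
        real_inner_smul_left, smul_eq_mul, nsmul_eq_mul]
      push_cast
      field_simp
    rw [add_apply, e, fderiv_eq_inner_gradient (hfd x)] at h
    rw [inner_sub_left, inner_sub_left, inner_neg_left, ContinuousLinearMap.adjoint_inner_left]
    linarith

/-- The optimality conditions of the master problem have a solution. -/
theorem exists_master {X : Set (E n)} (hX : X.Nonempty) (hXc : IsClosed X)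
    (hXconv : Convex ℝ X) {f : E n → ℝ} (hf : ContDiff ℝ 1 f) (hfconv : ConvexOn ℝ Set.univ f)
    {g : E m → ℝ} (hg : ConvexOn ℝ Set.univ g) {L : ℝ} (hL0 : 0 ≤ L)
    (hL : ∀ a b : E m, g b - g a ≤ L * ‖b - a‖) (B : E n →L[ℝ] E m) (b : E m) (c : E n) {t : ℝ}
    (ht : 0 < t) :
    ∃ (x : E n) (y : E m), y ∈ subdiff g (b + B (x - c)) ∧
      -gradient f x - ContinuousLinearMap.adjoint B y - (1 / t) • (x - c) ∈ normalCone X x := by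
  have hfd : Differentiable ℝ f := hf.differentiable one_ne_zero
  -- Penalty parameters k + 1 → ∞. The scaled constraint violation y k is a subgradient of g, hence
  -- bounded by L, which forces the violation itself to 0.
  choose x w hy hx using fun k : ℕ => exists_penalized hX hXc hXconv hf hfconv hg hL0 hL B b c ht
    (Nat.cast_add_one_pos k : (0 : ℝ) < k + 1)
  set y : ℕ → E m := fun k => ((k : ℝ) + 1) • (b + B (x k - c) - w k) with hydef
  have hyL : ∀ k, ‖y k‖ ≤ L := fun k => norm_le_of_mem_subdiff hL0 hL (hy k)
  obtain ⟨x₀, hx₀⟩ := hX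
  -- Monotonicity of the gradient of f and the prox term make the x-condition strongly monotone;
  -- testing it at a fixed point of X bounds x k.
  have hxb : ∀ k, ‖x k - x₀‖ ≤ t * (‖gradient f x₀‖ + ‖ContinuousLinearMap.adjoint B‖ * L
      + ‖(1 / t) • (x₀ - c)‖) := by
    intro k
    set N := ‖gradient f x₀‖ + ‖ContinuousLinearMap.adjoint B‖ * L + ‖(1 / t) • (x₀ - c)‖ with hN
    have h1 := (hx k).2 x₀ hx₀
    have h2 := inner_sub_nonneg_of_mem_subdiff (gradient_mem_subdiff hfd hfconv (x k))
      (gradient_mem_subdiff hfd hfconv x₀)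
    have h3 : -gradient f (x k) - ContinuousLinearMap.adjoint B (y k) - (1 / t) • (x k - c)
        = -(gradient f (x k) - gradient f x₀) - (gradient f x₀
          + ContinuousLinearMap.adjoint B (y k) + (1 / t) • (x₀ - c))
          - (1 / t) • (x k - x₀) := by module
    have h4 : x₀ - x k = -(x k - x₀) := by abel
    rw [h3, h4, inner_neg_right, inner_sub_left, inner_sub_left, inner_neg_left,
      real_inner_smul_left, real_inner_self_eq_norm_sq] at h1
    have h5 : -inner ℝ (gradient f x₀ + ContinuousLinearMap.adjoint B (y k) + (1 / t) • (x₀ - c))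
        (x k - x₀) ≤ N * ‖x k - x₀‖ := by
      refine (neg_le_abs _).trans ((abs_real_inner_le_norm _ _).trans ?_)
      refine mul_le_mul_of_nonneg_right ((norm_add₃_le).trans ?_) (norm_nonneg _)
      have : ‖ContinuousLinearMap.adjoint B (y k)‖ ≤ ‖ContinuousLinearMap.adjoint B‖ * L :=
        (ContinuousLinearMap.le_opNorm _ _).trans
          (mul_le_mul_of_nonneg_left (hyL k) (norm_nonneg _))
      linarith
    have hN0 : 0 ≤ N := by positivity
    have h6 : 1 / t * ‖x k - x₀‖ ^ 2 ≤ N * ‖x k - x₀‖ := by linarith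
    have h7 : ‖x k - x₀‖ * ‖x k - x₀‖ ≤ t * N * ‖x k - x₀‖ := by
      have := mul_le_mul_of_nonneg_left h6 ht.le
      have e : t * (1 / t * ‖x k - x₀‖ ^ 2) = ‖x k - x₀‖ * ‖x k - x₀‖ := by field_simp
      linarith
    rcases (norm_nonneg (x k - x₀)).eq_or_lt with h0 | h0
    · rw [← h0]; positivity
    · exact le_of_mul_le_mul_right h7 h0
  set R := t * (‖gradient f x₀‖ + ‖ContinuousLinearMap.adjoint B‖ * L
      + ‖(1 / t) • (x₀ - c)‖)
  obtain ⟨⟨x', y'⟩, -, φ, hφ, hlim⟩ := ((isCompact_closedBall x₀ R).prod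
    (isCompact_closedBall (0 : E m) L)).tendsto_subseq (x := fun k => (x k, y k))
    (fun k => ⟨by simpa [dist_eq_norm] using hxb k, by simpa using hyL k⟩)
  have hxl : Tendsto (fun k => x (φ k)) atTop (𝓝 x') := (continuous_fst.tendsto _).comp hlim
  have hyl : Tendsto (fun k => y (φ k)) atTop (𝓝 y') := (continuous_snd.tendsto _).comp hlim
  have hw : ∀ k, w k = b + B (x k - c) - ((k : ℝ) + 1)⁻¹ • y k := by
    intro k
    rw [hydef]
    simp only
    rw [smul_smul, inv_mul_cancel₀ (Nat.cast_add_one_ne_zero k), one_smul]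
    abel
  have hinv : Tendsto (fun k => ((φ k : ℝ) + 1)⁻¹) atTop (𝓝 0) := by
    have := (tendsto_one_div_add_atTop_nhds_zero_nat (𝕜 := ℝ)).comp hφ.tendsto_atTop
    simpa [Function.comp_def] using this
  have hwl : Tendsto (fun k => w (φ k)) atTop (𝓝 (b + B (x' - c))) := by
    have h1 : Tendsto (fun k => b + B (x (φ k) - c) - ((φ k : ℝ) + 1)⁻¹ • y (φ k)) atTop
        (𝓝 (b + B (x' - c) - (0 : ℝ) • y')) :=
      (tendsto_const_nhds.add ((B.continuous.tendsto _).comp (hxl.sub_const c))).sub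
        (hinv.smul hyl)
    rw [zero_smul, sub_zero] at h1
    exact h1.congr fun k => (hw _).symm
  refine ⟨x', y', mem_subdiff_of_tendsto (continuous_of_sub_le hL) hyl hwl fun k => hy _, ?_⟩
  refine mem_normalCone_of_tendsto hXc ?_ hxl fun k => hx (φ k)
  exact ((((continuous_gradient hf).tendsto _).comp hxl).neg.sub
    (((ContinuousLinearMap.adjoint B).continuous.tendsto _).comp hyl)).sub
      ((hxl.sub_const c).const_smul _)

/-- The master problem over the zero-dimensional space, with B = 0 and b = z, has a multiplier, and
this is a subgradient at z. -/
theorem subdiff_nonempty {g : E m → ℝ} (hg : ConvexOn ℝ Set.univ g) {L : ℝ} (hL0 : 0 ≤ L)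
    (hL : ∀ a b : E m, g b - g a ≤ L * ‖b - a‖) (z : E m) : (subdiff g z).Nonempty := by
  obtain ⟨x, y, hy, -⟩ := exists_master (n := 0) (X := Set.univ) (f := fun _ => 0)
    Set.univ_nonempty isClosed_univ convex_univ contDiff_const (convexOn_const 0 convex_univ)
    hg hL0 hL 0 z 0 one_pos
  exact ⟨y, by simpa using hy⟩

/-- An approximate subgradient is close to a subgradient at a nearby point. -/
theorem exists_mem_subdiff_near {g : E m → ℝ} (hg : ConvexOn ℝ Set.univ g) {L : ℝ} (hL0 : 0 ≤ L)
    (hL : ∀ a b : E m, g b - g a ≤ L * ‖b - a‖) {c y : E m} {e : ℝ}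
    (hy : ∀ w, g c + inner ℝ y (w - c) - e ≤ g w) :
    ∃ z y', y' ∈ subdiff g z ∧ ‖z - c‖ ^ 2 ≤ e ∧ ‖y' - y‖ ^ 2 ≤ e := by
  have hfg : ∀ x, HasGradientAt (fun x : E m => -inner ℝ y x) (-y) x := by
    intro x
    rw [hasGradientAt_iff_hasFDerivAt]
    have h : InnerProductSpace.toDual ℝ (E m) (-y) = -innerSL ℝ y := by ext; simp
    rw [h]
    exact (innerSL ℝ y).hasFDerivAt.neg
  -- Here z is the proximal point of g - ⟨y, ·⟩ at c. Its optimality condition reads y - y' = z - c,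
  -- and adding the two subgradient inequalities yields ‖z - c‖² = ⟨y - y', z - c⟩ ≤ e.
  obtain ⟨z, y', hy', hz⟩ := exists_master (X := Set.univ) (f := fun x : E m => -inner ℝ y x)
    Set.univ_nonempty isClosed_univ convex_univ (innerSL ℝ y).contDiff.neg
    ⟨convex_univ, fun a _ b _ s r _ _ _ => by
      simp only [inner_add_right, real_inner_smul_right, smul_eq_mul]; linarith⟩
    hg hL0 hL (ContinuousLinearMap.id ℝ (E m)) c c one_pos
  rw [(hfg z).gradient] at hz
  have hid : c + ContinuousLinearMap.id ℝ (E m) (z - c) = z := by simp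
  rw [hid] at hy'
  have hadj : ContinuousLinearMap.adjoint (ContinuousLinearMap.id ℝ (E m)) y' = y' := by
    refine ext_inner_right ℝ fun v => ?_
    rw [ContinuousLinearMap.adjoint_inner_left]; rfl
  rw [hadj] at hz
  set v := - -y - y' - (1 / 1 : ℝ) • (z - c) with hv
  have hv0 : v = 0 := by
    have := hz.2 (z + v) trivial
    rw [add_sub_cancel_left] at this
    rw [real_inner_self_eq_norm_sq] at this
    exact norm_eq_zero.1 (pow_eq_zero_iff two_ne_zero |>.1 (le_antisymm this (sq_nonneg _)))
  have hyy : y - y' = z - c := by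
    have : v = (y - y') - (z - c) := by rw [hv]; module
    rw [this] at hv0
    exact sub_eq_zero.1 hv0
  have h1 := hy z
  have h2 := hy' c
  have h3 : ‖z - c‖ ^ 2 ≤ e := by
    have e1 : inner ℝ (y - y') (z - c) = ‖z - c‖ ^ 2 := by
      rw [hyy, real_inner_self_eq_norm_sq]
    rw [inner_sub_left] at e1
    have e2 : inner ℝ y' (c - z) = -inner ℝ y' (z - c) := by rw [← inner_neg_right, neg_sub]
    linarith
  refine ⟨z, y', hy', h3, ?_⟩
  rw [norm_sub_rev, hyy]
  exact h3

end ConvexAnalysis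

end CompositeBundle

namespace CompositeBundle

open Filter Topology

variable {n m : ℕ} {P : Problem n m} {A : Params n}

/-! ### Smoothness of F and its linearization error. -/

section Smoothness

theorem Problem.Assumptions.contDiff_F (hP : P.Assumptions) : ContDiff ℝ 1 P.F :=
  contDiff_euclidean.2 hP.smooth_F

theorem Problem.Assumptions.differentiable_F (hP : P.Assumptions) : Differentiable ℝ P.F :=
  hP.contDiff_F.differentiable one_ne_zero

theorem Problem.Assumptions.differentiable_f₀ (hP : P.Assumptions) : Differentiable ℝ P.f₀ :=
  hP.smooth_f₀.differentiable one_ne_zero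

theorem Problem.Assumptions.fderiv_F_apply (hP : P.Assumptions) (x v : E n) (i : Fin m) :
    fderiv ℝ P.F x v i = inner ℝ (gradient (P.comp i) x) v := by
  have h1 : HasFDerivAt (P.comp i) ((EuclideanSpace.proj (𝕜 := ℝ) i).comp (fderiv ℝ P.F x)) x :=
    (EuclideanSpace.proj (𝕜 := ℝ) i).hasFDerivAt.comp x (hP.differentiable_F x).hasFDerivAt
  rw [← fderiv_eq_inner_gradient h1.differentiableAt, h1.fderiv]
  rfl

theorem Problem.Assumptions.adjoint_fderiv_F (hP : P.Assumptions) (x : E n) (y : E m) :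
    ContinuousLinearMap.adjoint (fderiv ℝ P.F x) y = ∑ i, y i • gradient (P.comp i) x := by
  refine ext_inner_right ℝ fun v => ?_
  rw [ContinuousLinearMap.adjoint_inner_left, PiLp.inner_apply, sum_inner]
  refine Finset.sum_congr rfl fun i _ => ?_
  rw [hP.fderiv_F_apply, real_inner_smul_left]
  simp [mul_comm]

theorem norm_le_sum_abs (w : E m) : ‖w‖ ≤ ∑ i, |w i| := by
  rw [EuclideanSpace.norm_eq]
  refine Real.sqrt_le_iff.2 ⟨Finset.sum_nonneg fun i _ => abs_nonneg _, ?_⟩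
  simp only [Real.norm_eq_abs]
  exact Finset.sum_sq_le_sq_sum_of_nonneg fun i _ => abs_nonneg _

theorem Problem.Assumptions.exists_lipschitz_fderiv_F (hP : P.Assumptions) :
    ∃ L : ℝ, 0 < L ∧ ∀ x ∈ P.X, ∀ x' ∈ P.X,
      ‖fderiv ℝ P.F x - fderiv ℝ P.F x'‖ ≤ L * ‖x - x'‖ := by
  choose L hL0 hL using hP.lipschitz_grad
  have hs : 0 ≤ ∑ i, 1 / 2 * L i := Finset.sum_nonneg fun i _ => by linarith [hL0 i]
  -- The summand 1 keeps the constant positive when m = 0.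
  refine ⟨∑ i, 1 / 2 * L i + 1, by linarith, fun x hx x' hx' => ?_⟩
  refine ContinuousLinearMap.opNorm_le_bound _ (by positivity) fun v => ?_
  calc ‖(fderiv ℝ P.F x - fderiv ℝ P.F x') v‖
      ≤ ∑ i, |(fderiv ℝ P.F x - fderiv ℝ P.F x') v i| := norm_le_sum_abs _
    _ ≤ ∑ i, 1 / 2 * L i * ‖x - x'‖ * ‖v‖ := by
        refine Finset.sum_le_sum fun i _ => ?_
        rw [sub_apply, PiLp.sub_apply, hP.fderiv_F_apply, hP.fderiv_F_apply, ← inner_sub_left]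
        exact (abs_real_inner_le_norm _ _).trans
          (mul_le_mul_of_nonneg_right (hL i x hx x' hx') (norm_nonneg _))
    _ = (∑ i, 1 / 2 * L i) * (‖x - x'‖ * ‖v‖) := by
        rw [Finset.sum_mul]; exact Finset.sum_congr rfl fun i _ => by ring
    _ ≤ (∑ i, 1 / 2 * L i + 1) * ‖x - x'‖ * ‖v‖ := by
        rw [mul_assoc]
        exact mul_le_mul_of_nonneg_right (by linarith) (by positivity)

/-- The mean value inequality on the segment from x to x', which stays in X, where the derivative
differs from its value at x by at most L‖x' - x‖. -/
theorem Problem.Assumptions.norm_linearization_error_le (hP : P.Assumptions) {L : ℝ} (hL0 : 0 ≤ L)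
    (hL : ∀ x ∈ P.X, ∀ x' ∈ P.X, ‖fderiv ℝ P.F x - fderiv ℝ P.F x'‖ ≤ L * ‖x - x'‖)
    {x x' : E n} (hx : x ∈ P.X) (hx' : x' ∈ P.X) :
    ‖P.F x' - (P.F x + fderiv ℝ P.F x (x' - x))‖ ≤ L * ‖x' - x‖ ^ 2 := by
  have h := (convex_segment (𝕜 := ℝ) x x').norm_image_sub_le_of_norm_fderiv_le'
    (f := P.F) (φ := fderiv ℝ P.F x) (C := L * ‖x' - x‖)
    (fun u _ => hP.differentiable_F u)
    (fun u hu => (hL u (hP.convex_X.segment_subset hx hx' hu) x hx).trans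
      (mul_le_mul_of_nonneg_left (by
        obtain ⟨θ, hθ, rfl⟩ := (segment_eq_image' ℝ x x') ▸ hu
        rw [add_sub_cancel_left, norm_smul, Real.norm_of_nonneg hθ.1]
        exact mul_le_of_le_one_left (norm_nonneg _) hθ.2) hL0))
    (left_mem_segment ℝ x x') (right_mem_segment ℝ x x')
  rw [← sub_sub, pow_two, ← mul_assoc]
  exact h

end Smoothness

/-! ### Uniform constants for the problem and the parameters. -/

/-- Constants that bound the data of the problem: a Lipschitz constant of `h`, a Lipschitz constant
of the derivative of `F` on `X`, a bound on this derivative on the initial level set, and a lower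
bound on all prox-parameters. -/
structure Bounds (P : Problem n m) (A : Params n) (Lh LF G tmin : ℝ) : Prop where
  Lh_pos : 0 < Lh
  h_sub_le : ∀ a b : E m, P.h b - P.h a ≤ Lh * ‖b - a‖
  LF_pos : 0 < LF
  fderiv_sub_le : ∀ x ∈ P.X, ∀ x' ∈ P.X,
    ‖fderiv ℝ P.F x - fderiv ℝ P.F x'‖ ≤ LF * ‖x - x'‖
  G_nonneg : 0 ≤ G
  fderiv_le : ∀ x ∈ P.X, P.obj x ≤ P.obj A.x₀ → ‖fderiv ℝ P.F x‖ ≤ G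
  tmin_pos : 0 < tmin
  tmin_le : tmin ≤ A.tlow
  tmin_mul_le : tmin * (2 * Lh * LF * A.τ) ≤ A.κ

theorem Problem.Assumptions.continuous_h (hP : P.Assumptions) : Continuous P.h := by
  obtain ⟨L, -, hL⟩ := hP.lipschitz_h
  exact continuous_of_sub_le fun a b => (abs_le.1 (hL b a)).2

theorem Problem.Assumptions.continuous_obj (hP : P.Assumptions) : Continuous P.obj :=
  hP.smooth_f₀.continuous.add (hP.continuous_h.comp hP.contDiff_F.continuous)

theorem Problem.Assumptions.isCompact_level (hP : P.Assumptions) {x₀ : E n}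
    (hlev : P.LevelBounded x₀) : IsCompact {x | x ∈ P.X ∧ P.obj x ≤ P.obj x₀} :=
  Metric.isCompact_of_isClosed_isBounded
    (hP.closed_X.inter (isClosed_le hP.continuous_obj continuous_const)) hlev

theorem exists_bounds (hP : P.Assumptions) (hA : A.Valid P) (hlev : P.LevelBounded A.x₀) :
    ∃ Lh LF G tmin : ℝ, Bounds P A Lh LF G tmin := by
  obtain ⟨Lh, hLh0, hLh⟩ := hP.lipschitz_h
  obtain ⟨LF, hLF0, hLF⟩ := hP.exists_lipschitz_fderiv_F
  obtain ⟨G, hG⟩ := (hP.isCompact_level hlev).exists_bound_of_continuousOn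
    (f := fderiv ℝ P.F) (hP.contDiff_F.continuous_fderiv one_ne_zero).continuousOn
  have hτ : 0 < A.τ := one_pos.trans hA.one_lt_τ
  have hpos : 0 < 2 * Lh * LF * A.τ := by positivity
  refine ⟨Lh, LF, G, min A.tlow (A.κ / (2 * Lh * LF * A.τ)), hLh0,
    fun a b => (abs_le.1 (hLh b a)).2, hLF0, hLF,
    (norm_nonneg _).trans (hG A.x₀ ⟨hA.x₀_mem, le_rfl⟩), fun x hx hx' => hG x ⟨hx, hx'⟩,
    lt_min hA.tlow_pos (div_pos hA.κ_pos hpos), min_le_left _ _, ?_⟩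
  exact (le_div_iff₀ hpos).1 (min_le_right _ _)

/-! ### A single iteration: trial points, invariants and updates. -/

section Trial

variable {s s' : State n m} {T : Trial n m}

/-- The optimal value of the master problem grows quadratically away from its solution, even after
the model has been replaced by its linearization. -/
theorem IsTrial.growth (hP : P.Assumptions) (ht : 0 < s.t) (hT : IsTrial P s T) {x : E n}
    (hx : x ∈ P.X) :
    P.f₀ T.x + 1 / (2 * s.t) * ‖T.x - s.center‖ ^ 2 + 1 / (2 * s.t) * ‖x - T.x‖ ^ 2 ≤
      P.f₀ x + inner ℝ T.y (P.F s.center + fderiv ℝ P.F s.center (x - s.center) - T.z)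
        + 1 / (2 * s.t) * ‖x - s.center‖ ^ 2 := by
  have h1 := gradient_mem_subdiff hP.differentiable_f₀ hP.convex_f₀ T.x x
  have h2 := hT.x_opt.2 x hx
  rw [inner_sub_left, inner_sub_left, inner_neg_left, ContinuousLinearMap.adjoint_inner_left,
    real_inner_smul_left] at h2
  have h3 : P.F s.center + fderiv ℝ P.F s.center (x - s.center) - T.z
      = fderiv ℝ P.F s.center (x - T.x) := by
    rw [hT.z_eq, add_sub_add_left_eq_sub, ← map_sub, sub_sub_sub_cancel_right]
  rw [h3]
  -- The exact expansion of the prox term supplies the quadratic growth; f₀ contributes its gradient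
  -- inequality and X its normal cone.
  have h4 : ‖x - s.center‖ ^ 2 = ‖T.x - s.center‖ ^ 2 + 2 * inner ℝ (T.x - s.center) (x - T.x)
      + ‖x - T.x‖ ^ 2 := by
    rw [← norm_add_sq_real]
    congr 2
    abel
  have h5 : 1 / (2 * s.t) * ‖x - s.center‖ ^ 2 = 1 / (2 * s.t) * ‖T.x - s.center‖ ^ 2
      + 1 / s.t * inner ℝ (T.x - s.center) (x - T.x) + 1 / (2 * s.t) * ‖x - T.x‖ ^ 2 := by
    rw [h4]; field_simp
  linarith

/-- Growth evaluated at x = x̂. The two prox terms, each with factor 1/(2t), add up to 1/t. -/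
theorem IsTrial.le_predDecrease (hP : P.Assumptions) (ht : 0 < s.t) (hc : s.center ∈ P.X)
    (hT : IsTrial P s T) :
    P.h (P.F s.center) - s.model T.z - inner ℝ T.y (P.F s.center - T.z)
      + 1 / s.t * ‖T.x - s.center‖ ^ 2 ≤ predDecrease P s T := by
  have h := hT.growth hP ht hc
  rw [sub_self, map_zero, add_zero, norm_zero, norm_sub_rev s.center] at h
  have h2 : 1 / s.t * ‖T.x - s.center‖ ^ 2 = 1 / (2 * s.t) * ‖T.x - s.center‖ ^ 2
    + 1 / (2 * s.t) * ‖T.x - s.center‖ ^ 2 := by field_simp; ring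
  unfold predDecrease
  linarith

theorem IsTrial.linearization_gap_nonneg (hs : IsLowerModel P.h s.model) (hT : IsTrial P s T) :
    0 ≤ P.h (P.F s.center) - s.model T.z - inner ℝ T.y (P.F s.center - T.z) := by
  linarith [hT.y_mem (P.F s.center), hs.2 (P.F s.center)]

theorem IsTrial.norm_sq_le (hP : P.Assumptions) (ht : 0 < s.t) (hc : s.center ∈ P.X)
    (hs : IsLowerModel P.h s.model) (hT : IsTrial P s T) :
    1 / s.t * ‖T.x - s.center‖ ^ 2 ≤ predDecrease P s T := by
  linarith [hT.le_predDecrease hP ht hc, hT.linearization_gap_nonneg hs]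

theorem IsTrial.predDecrease_nonneg (hP : P.Assumptions) (ht : 0 < s.t) (hc : s.center ∈ P.X)
    (hs : IsLowerModel P.h s.model) (hT : IsTrial P s T) : 0 ≤ predDecrease P s T :=
  le_trans (by positivity) (hT.norm_sq_le hP ht hc hs)

/-- Each solution is inserted into the growth inequality of the other; after adding, monotonicity of
the model's subdifferential leaves only the quadratic terms. The multiplier y need not be unique. -/
theorem IsTrial.x_unique (hP : P.Assumptions) (ht : 0 < s.t) {T' : Trial n m}
    (hT : IsTrial P s T) (hT' : IsTrial P s T') : T'.x = T.x := by
  have h1 := hT.growth hP ht hT'.x_opt.1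
  have h2 := hT'.growth hP ht hT.x_opt.1
  rw [← hT'.z_eq] at h1
  rw [← hT.z_eq] at h2
  have h3 := inner_sub_nonneg_of_mem_subdiff hT.y_mem hT'.y_mem
  rw [inner_sub_left] at h3
  have e : inner ℝ T.y (T'.z - T.z) = -inner ℝ T.y (T.z - T'.z) := by
    rw [← inner_neg_right, neg_sub]
  rw [norm_sub_rev T.x T'.x] at h2
  have h4 : 1 / (2 * s.t) * ‖T'.x - T.x‖ ^ 2 ≤ 0 := by linarith
  have h5 : ‖T'.x - T.x‖ ^ 2 ≤ 0 := by
    by_contra! hlt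
    have : 0 < 1 / (2 * s.t) * ‖T'.x - T.x‖ ^ 2 := by positivity
    linarith
  exact sub_eq_zero.1 (norm_eq_zero.1 (pow_eq_zero_iff two_ne_zero |>.1
    (le_antisymm h5 (sq_nonneg _))))

/-- The properties of the state that the algorithm maintains. -/
structure State.Good (P : Problem n m) (A : Params n) (tmin : ℝ) (s : State n m) : Prop where
  center_mem : s.center ∈ P.X
  obj_le : P.obj s.center ≤ P.obj A.x₀
  tmin_le : tmin ≤ s.tlow
  tlow_le : s.tlow ≤ s.t
  t_le : s.t ≤ A.tmax
  lower : IsLowerModel P.h s.model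
  slope_mem : s.slope ∈ subdiff P.h (P.F s.center)

variable {Lh LF G tmin : ℝ}

theorem IsInit.good (hA : A.Valid P) (hB : Bounds P A Lh LF G tmin) (hs : IsInit P A s) :
    s.Good P A tmin where
  center_mem := hs.center_eq ▸ hA.x₀_mem
  obj_le := by rw [hs.center_eq]
  tmin_le := hs.tlow_eq ▸ hB.tmin_le
  tlow_le := by rw [hs.tlow_eq, hs.t_eq]; exact hA.tlow_lt.le
  t_le := hs.t_eq ▸ hA.t₀_lt.le
  lower := hs.lower
  slope_mem := hs.slope_mem

theorem State.Good.t_pos (hB : Bounds P A Lh LF G tmin) (hs : s.Good P A tmin) : 0 < s.t :=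
  hB.tmin_pos.trans_le (hs.tmin_le.trans hs.tlow_le)

/-- Backtracking happens only for large prox-parameters. -/
theorem tmin_le_div_of_backtracking (hP : P.Assumptions) (hA : A.Valid P)
    (hB : Bounds P A Lh LF G tmin) (hs : s.Good P A tmin) (hT : IsTrial P s T)
    (h₁ : Test₁ P A s T) (h₂ : ¬ Test₂ P A s T) : tmin ≤ s.t / A.τ := by
  have ht := hs.t_pos hB
  have hτ : 0 < A.τ := one_pos.trans hA.one_lt_τ
  have hLh := hB.Lh_pos
  have hLF := hB.LF_pos
  have hv := hT.norm_sq_le hP ht hs.center_mem hs.lower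
  unfold Test₁ at h₁
  unfold Test₂ at h₂
  have h3 := hB.h_sub_le T.z (P.F T.x)
  have h4 := hP.norm_linearization_error_le hLF.le hB.fderiv_sub_le hs.center_mem hT.x_opt.1
  rw [← hT.z_eq] at h4
  have h5 := mul_le_mul_of_nonneg_left h4 hLh.le
  have h6 := mul_le_mul_of_nonneg_left hv hA.κ_pos.le
  set d := ‖T.x - s.center‖ ^ 2 with hd
  have hd0 : 0 ≤ d := sq_nonneg _
  -- Passing the first test and failing the second means h(F(x)) - h(z) > κv/2. The left side is at
  -- most Lh·LF·d, and v ≥ d/t.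
  have h7 : A.κ * (1 / s.t * d) < 2 * Lh * LF * d := by nlinarith
  have h8 : A.κ * d < 2 * Lh * LF * s.t * d := by
    have := mul_lt_mul_of_pos_left h7 ht
    have e : s.t * (A.κ * (1 / s.t * d)) = A.κ * d := by field_simp
    nlinarith
  have h9 : A.κ < 2 * Lh * LF * s.t := lt_of_mul_lt_mul_right h8 hd0
  rw [le_div_iff₀ hτ]
  have h10 := hB.tmin_mul_le
  have h11 : (2 * Lh * LF) * (tmin * A.τ) ≤ (2 * Lh * LF) * s.t := by linarith
  exact le_of_mul_le_mul_left h11 (by positivity)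

theorem State.Good.update (hP : P.Assumptions) (hA : A.Valid P) (hB : Bounds P A Lh LF G tmin)
    (hs : s.Good P A tmin) (hT : IsTrial P s T) (hU : Update P A s T s') : s'.Good P A tmin := by
  have ht := hs.t_pos hB
  by_cases h₁ : Test₁ P A s T
  · by_cases h₂ : Test₂ P A s T
    · obtain ⟨hc, ⟨ht1, ht2⟩, hl, hsl, hlow, -⟩ := hU.1 h₁ h₂
      refine ⟨hc ▸ hT.x_opt.1, ?_, hl ▸ hs.tmin_le, hl ▸ hs.tlow_le.trans ht1, ht2, hlow, hsl⟩
      have := hT.predDecrease_nonneg hP ht hs.center_mem hs.lower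
      have h3 := hs.obj_le
      unfold Test₂ at h₂
      rw [hc]
      unfold Problem.obj at h3 ⊢
      nlinarith [hA.κ_pos]
    · obtain ⟨hc, hsl, ht', hl, hmod⟩ := hU.2.1 h₁ h₂
      refine ⟨hc ▸ hs.center_mem, hc ▸ hs.obj_le, ?_, ?_, ?_, hmod.1, ?_⟩
      · rw [hl]
        exact le_min (tmin_le_div_of_backtracking hP hA hB hs hT h₁ h₂) hs.tmin_le
      · rw [hl, ht']; exact min_le_left _ _
      · rw [ht']; exact (div_le_self ht.le hA.one_lt_τ.le).trans hs.t_le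
      · rw [hc, hsl]; exact hs.slope_mem
  · obtain ⟨hc, hsl, ht', hl, hmod⟩ := hU.2.2 h₁
    refine ⟨hc ▸ hs.center_mem, hc ▸ hs.obj_le, hl ▸ hs.tmin_le, hl ▸ ht'.1,
      ht'.2.trans hs.t_le, hmod.1, ?_⟩
    rw [hc, hsl]; exact hs.slope_mem

theorem Bounds.model_sub_le (hB : Bounds P A Lh LF G tmin) {g : E m → ℝ}
    (hg : IsLowerModel P.h g) (a b : E m) : g b - g a ≤ Lh * ‖b - a‖ :=
  hg.sub_le (fun z z' => abs_le.2 ⟨by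
    have := hB.h_sub_le z z'
    rw [norm_sub_rev] at this
    linarith, hB.h_sub_le z' z⟩) a b

theorem State.Good.exists_trial (hP : P.Assumptions) (hB : Bounds P A Lh LF G tmin)
    (hs : s.Good P A tmin) : ∃ T, IsTrial P s T := by
  obtain ⟨x, y, hy, hx⟩ := exists_master hP.nonempty_X hP.closed_X hP.convex_X hP.smooth_f₀
    hP.convex_f₀ hs.lower.1 hB.Lh_pos.le (hB.model_sub_le hs.lower) (fderiv ℝ P.F s.center)
    (P.F s.center) s.center (hs.t_pos hB)
  exact ⟨⟨x, y, _⟩, rfl, hy, hx⟩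

theorem State.Good.exists_update (hP : P.Assumptions) (hB : Bounds P A Lh LF G tmin)
    (hs : s.Good P A tmin) (hT : IsTrial P s T) : ∃ s', Update P A s T s' := by
  -- The function h itself is always an admissible new model.
  have hlow : IsLowerModel P.h P.h := ⟨hP.convex_h, fun _ => le_rfl⟩
  have hsub := subdiff_nonempty hP.convex_h hB.Lh_pos.le hB.h_sub_le
  have hmod : ∀ s' : State n m, s'.model = P.h → ModelUpdate P s T s' := by
    intro s' h'
    unfold ModelUpdate
    rw [h']
    obtain ⟨g, hg⟩ := hsub T.z
    exact ⟨hlow, hs.slope_mem, ⟨g, hg, hg⟩, fun z => (hT.y_mem z).trans (hs.lower.2 z)⟩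
  by_cases h₁ : Test₁ P A s T
  · by_cases h₂ : Test₂ P A s T
    · obtain ⟨g, hg⟩ := hsub (P.F T.x)
      exact ⟨⟨T.x, g, s.t, s.tlow, P.h⟩,
        fun _ _ => ⟨rfl, ⟨le_rfl, hs.t_le⟩, rfl, hg, hlow, hg⟩,
        fun _ h => absurd h₂ h, fun h => absurd h₁ h⟩
    · exact ⟨⟨s.center, s.slope, s.t / A.τ, min (s.t / A.τ) s.tlow, P.h⟩,
        fun _ h => absurd h h₂, fun _ _ => ⟨rfl, rfl, rfl, rfl, hmod _ rfl⟩,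
        fun h => absurd h₁ h⟩
  · exact ⟨⟨s.center, s.slope, s.t, s.tlow, P.h⟩, fun h => absurd h h₁, fun h => absurd h h₁,
      fun _ => ⟨rfl, rfl, ⟨hs.tlow_le, le_rfl⟩, rfl, hmod _ rfl⟩⟩

end Trial

/-! ### Well-definedness of the algorithm. -/

section WellDefined

variable {Lh LF G tmin Tol : ℝ}

theorem Run.good_of_active (hP : P.Assumptions) (hA : A.Valid P) (hB : Bounds P A Lh LF G tmin)
    {r : Run n m} {K : ℕ} (h0 : IsInit P A (r.state 0)) (hr : ∀ k < K, r.Obeys P A Tol k)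
    (hact : r.Active P Tol K) : (r.state K).Good P A tmin := by
  induction K with
  | zero => exact h0.good hA hB
  | succ k ih =>
    have hact' : r.Active P Tol k := fun j hj => hact j (hj.trans k.lt_succ_self)
    have hg := ih (fun j hj => hr j (hj.trans k.lt_succ_self)) hact'
    obtain ⟨hT, hU⟩ := hr k k.lt_succ_self hact'
    exact hg.update hP hA hB hT (hU (hact k k.lt_succ_self))

theorem exists_isInit (hP : P.Assumptions) (hB : Bounds P A Lh LF G tmin) :
    ∃ s : State n m, IsInit P A s := by
  obtain ⟨g, hg⟩ := subdiff_nonempty hP.convex_h hB.Lh_pos.le hB.h_sub_le (P.F A.x₀)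
  exact ⟨⟨A.x₀, g, A.t₀, A.tlow, P.h⟩, rfl, hg, rfl, rfl, hP.convex_h, fun _ => le_rfl⟩

theorem Run.IsPartial.exists_extension (hP : P.Assumptions) (hA : A.Valid P)
    (hB : Bounds P A Lh LF G tmin) {K : ℕ} {r : Run n m} (hr : r.IsPartial P A Tol K) :
    ∃ r' : Run n m, r'.IsExecution P A Tol ∧
      (∀ k ≤ K, r'.state k = r.state k) ∧ (∀ k < K, r'.trial k = r.trial k) := by
  classical
  -- The default values are reached only where the algorithm has already stopped; in active
  -- iterations the invariant `State.Good` guarantees that the choices exist.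
  let trialOf : State n m → Trial n m := fun s =>
    if h : ∃ T, IsTrial P s T then h.choose else ⟨0, 0, 0⟩
  let stateOf : State n m → Trial n m → State n m := fun s T =>
    if h : ∃ s', Update P A s T s' then h.choose else s
  let st : ℕ → State n m := Nat.rec (r.state 0) fun k s =>
    if k + 1 ≤ K then r.state (k + 1) else stateOf s (trialOf s)
  have st_succ : ∀ k, st (k + 1) =
    if k + 1 ≤ K then r.state (k + 1) else stateOf (st k) (trialOf (st k)) := fun k => rfl
  let r' : Run n m := ⟨st, fun k => if k < K then r.trial k else trialOf (st k)⟩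
  have hst : ∀ k ≤ K, r'.state k = r.state k := by
    intro k hk
    cases k with
    | zero => rfl
    | succ k => exact (st_succ k).trans (if_pos hk)
  have htr : ∀ k < K, r'.trial k = r.trial k := fun k hk => if_pos hk
  have hinit : IsInit P A (r'.state 0) := hr.1
  refine ⟨r', ⟨hinit, fun k => ?_⟩, hst, htr⟩
  induction k using Nat.strong_induction_on with
  | _ k ih =>
    intro hact
    rcases lt_or_ge k K with hk | hk
    · have hv : ∀ j ≤ k, r'.v P j = r.v P j := fun j hj => by
        unfold Run.v
        rw [hst j (hj.trans hk.le), htr j (hj.trans_lt hk)]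
      have := hr.2 k hk fun j hj => hv j hj.le ▸ hact j hj
      rw [hst k hk.le, htr k hk, hst (k + 1) hk, hv k le_rfl]
      exact this
    · have hg := Run.good_of_active hP hA hB hinit ih hact
      have ht : r'.trial k = trialOf (st k) := if_neg hk.not_gt
      have hT : IsTrial P (r'.state k) (r'.trial k) := by
        have h : ∃ T, IsTrial P (st k) T := hg.exists_trial hP hB
        rw [ht]
        simp only [trialOf, dif_pos h]
        exact h.choose_spec
      refine ⟨hT, fun _ => ?_⟩
      have h : ∃ s', Update P A (st k) (trialOf (st k)) s' :=
        ht ▸ hg.exists_update hP hB hT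
      have hs : r'.state (k + 1) = stateOf (st k) (trialOf (st k)) :=
        (st_succ k).trans (if_neg (by omega))
      rw [ht, hs]
      simp only [stateOf, dif_pos h]
      exact h.choose_spec

theorem wellDefined (hP : P.Assumptions) (hA : A.Valid P) (hB : Bounds P A Lh LF G tmin) :
    WellDefined P A Tol := by
  refine ⟨exists_isInit hP hB, fun r hr k hk T hT => ?_, fun K r hr => hr.exists_extension hP hA hB⟩
  have hg := Run.good_of_active hP hA hB hr.1 (fun j _ => hr.2 j) hk
  have hT' := (hr.2 k hk).1
  have hx := hT'.x_unique hP (hg.t_pos hB) hT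
  exact ⟨hx, by rw [hT.z_eq, hT'.z_eq, hx]⟩

end WellDefined

end CompositeBundle

namespace CompositeBundle

open Filter Topology

variable {n m : ℕ} {P : Problem n m} {A : Params n} {Lh LF G tmin : ℝ}

/-! ### From small predicted decrease to approximate stationarity. -/

section Stationarity

theorem Problem.Assumptions.mem_S (hP : P.Assumptions) {x : E n} {y z : E m}
    {w : WithLp 2 (E m × WithLp 2 (E m × E n))} (h1 : w.fst = P.F x - z)
    (h2 : w.snd.fst + y ∈ subdiff P.h z)
    (h3 : w.snd.snd - gradient P.f₀ x - ContinuousLinearMap.adjoint (fderiv ℝ P.F x) y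
      ∈ normalCone P.X x) : w ∈ P.S x y z := by
  refine ⟨h1, Set.mem_sub.2 ⟨_, h2, y, rfl, by abel⟩, ?_⟩
  have hD : ∑ i, y i • convexHull ℝ (P.D i x)
      = {ContinuousLinearMap.adjoint (fderiv ℝ P.F x) y} := by
    rw [hP.adjoint_fderiv_F]
    simp only [Problem.D, convexHull_singleton, Set.smul_set_singleton]
    exact (map_sum (Set.singletonAddMonoidHom (α := E n)) _ _).symm
  rw [hD, Set.singleton_add_singleton]
  exact Set.mem_add.2 ⟨_, rfl, _, h3, by abel⟩

theorem Problem.Assumptions.zero_mem_S (hP : P.Assumptions) {x : E n} {y : E m}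
    (h2 : y ∈ subdiff P.h (P.F x))
    (h3 : -gradient P.f₀ x - ContinuousLinearMap.adjoint (fderiv ℝ P.F x) y ∈ normalCone P.X x) :
    0 ∈ P.S x y (P.F x) :=
  hP.mem_S (by simp) (by simpa using h2) (by simpa using h3)

/-- The bound on the stationarity residual at a trial point with predicted decrease at most `v`. -/
noncomputable def residual (A : Params n) (Lh LF G tmin v : ℝ) : ℝ :=
  LF * √(A.tmax * v) ^ 2 + G * √(A.tmax * v) + √v +
    ((G + LF * √(A.tmax * v)) * √v + LF * √(A.tmax * v) * Lh + √(A.tmax * v) / tmin)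

theorem continuous_residual (A : Params n) (Lh LF G tmin : ℝ) :
    Continuous (residual A Lh LF G tmin) := by
  unfold residual
  fun_prop

theorem residual_zero (A : Params n) (Lh LF G tmin : ℝ) : residual A Lh LF G tmin 0 = 0 := by
  simp [residual]

theorem Bounds.residual_nonneg (hB : Bounds P A Lh LF G tmin) (v : ℝ) :
    0 ≤ residual A Lh LF G tmin v := by
  have h1 := hB.Lh_pos
  have h2 := hB.LF_pos
  have h3 := hB.G_nonneg
  have h4 := hB.tmin_pos
  unfold residual
  positivity

variable {s : State n m} {T : Trial n m}

/-- Shifting the base point of the model's linearization from z to F(x̂) costs exactly the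
linearization gap, which the predicted decrease dominates. -/
theorem IsTrial.approx_subgradient (hs : IsLowerModel P.h s.model) (hT : IsTrial P s T) (w : E m) :
    P.h (P.F s.center) + inner ℝ T.y (w - P.F s.center)
      - (P.h (P.F s.center) - s.model T.z - inner ℝ T.y (P.F s.center - T.z)) ≤ P.h w := by
  have h1 := hT.y_mem w
  have h2 := hs.2 w
  have h3 : w - T.z = (w - P.F s.center) + (P.F s.center - T.z) := by abel
  rw [h3, inner_add_right] at h1
  linarith

theorem IsTrial.approx_stationary (hP : P.Assumptions) (hB : Bounds P A Lh LF G tmin)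
    (hs : s.Good P A tmin) (hT : IsTrial P s T) {v : ℝ} (hv : predDecrease P s T ≤ v) :
    ∃ (y z : E m) (u : E n), y ∈ subdiff P.h z ∧
      ‖P.F T.x - z‖ + ‖u‖ ≤ residual A Lh LF G tmin v ∧
      u - gradient P.f₀ T.x - ContinuousLinearMap.adjoint (fderiv ℝ P.F T.x) y
        ∈ normalCone P.X T.x := by
  have ht := hs.t_pos hB
  have hv0 := (hT.predDecrease_nonneg hP ht hs.center_mem hs.lower).trans hv
  have hgap : P.h (P.F s.center) - s.model T.z - inner ℝ T.y (P.F s.center - T.z) ≤ v := by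
    have := hT.le_predDecrease hP ht hs.center_mem
    have h2 : 0 ≤ 1 / s.t * ‖T.x - s.center‖ ^ 2 := by positivity
    linarith
  obtain ⟨z, y, hy, hz, hyy⟩ := exists_mem_subdiff_near hP.convex_h hB.Lh_pos.le hB.h_sub_le
    (hT.approx_subgradient hs.lower)
  have hz' : ‖z - P.F s.center‖ ≤ √v := Real.le_sqrt_of_sq_le (hz.trans hgap)
  have hy' : ‖y - T.y‖ ≤ √v := Real.le_sqrt_of_sq_le (hyy.trans hgap)
  have hd : ‖T.x - s.center‖ ≤ √(A.tmax * v) := by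
    refine Real.le_sqrt_of_sq_le ?_
    have h1 := (hT.norm_sq_le hP ht hs.center_mem hs.lower).trans hv
    have h2 := mul_le_mul_of_nonneg_left h1 ht.le
    have e : s.t * (1 / s.t * ‖T.x - s.center‖ ^ 2) = ‖T.x - s.center‖ ^ 2 := by field_simp
    rw [e] at h2
    exact h2.trans (mul_le_mul_of_nonneg_right hs.t_le hv0)
  set δ := √(A.tmax * v)
  have hδ : 0 ≤ δ := Real.sqrt_nonneg _
  have hLF := hB.LF_pos.le
  have hGc := hB.fderiv_le _ hs.center_mem hs.obj_le
  have hTyL : ‖T.y‖ ≤ Lh :=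
    norm_le_of_mem_subdiff hB.Lh_pos.le (hB.model_sub_le hs.lower) hT.y_mem
  have hdF : ‖fderiv ℝ P.F T.x - fderiv ℝ P.F s.center‖ ≤ LF * δ :=
    (hB.fderiv_sub_le _ hT.x_opt.1 _ hs.center_mem).trans (mul_le_mul_of_nonneg_left hd hLF)
  have hGx : ‖fderiv ℝ P.F T.x‖ ≤ G + LF * δ := by
    have : fderiv ℝ P.F T.x
      = fderiv ℝ P.F s.center + (fderiv ℝ P.F T.x - fderiv ℝ P.F s.center) := by abel
    rw [this]
    exact (norm_add_le _ _).trans (add_le_add hGc hdF)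
  -- The vector u is the error of replacing yₖ₊₁ by y and F'(x̂) by F'(x) in the optimality
  -- condition, together with the prox term; with it, the vector in the normal cone is the one from
  -- `x_opt`.
  refine ⟨y, z, ContinuousLinearMap.adjoint (fderiv ℝ P.F T.x) (y - T.y)
    + ContinuousLinearMap.adjoint (fderiv ℝ P.F T.x - fderiv ℝ P.F s.center) T.y
    - (1 / s.t) • (T.x - s.center), hy, ?_, ?_⟩
  · refine add_le_add ?_ ?_
    · have e : P.F T.x - z = (P.F T.x - (P.F s.center + fderiv ℝ P.F s.center (T.x - s.center)))
          + fderiv ℝ P.F s.center (T.x - s.center) + (P.F s.center - z) := by abel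
      rw [e]
      refine norm_add₃_le.trans (add_le_add (add_le_add ?_ ?_) ?_)
      · refine (hP.norm_linearization_error_le hLF hB.fderiv_sub_le hs.center_mem
          hT.x_opt.1).trans ?_
        gcongr
      · exact (ContinuousLinearMap.le_opNorm _ _).trans
          (mul_le_mul hGc hd (norm_nonneg _) hB.G_nonneg)
      · rwa [norm_sub_rev]
    · refine (norm_sub_le _ _).trans (add_le_add ((norm_add_le _ _).trans (add_le_add ?_ ?_)) ?_)
      · refine (ContinuousLinearMap.le_opNorm _ _).trans ?_
        rw [LinearIsometryEquiv.norm_map]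
        exact mul_le_mul hGx hy' (norm_nonneg _) ((norm_nonneg _).trans hGx)
      · refine (ContinuousLinearMap.le_opNorm _ _).trans ?_
        rw [LinearIsometryEquiv.norm_map]
        exact mul_le_mul hdF hTyL (norm_nonneg _) (by positivity)
      · rw [norm_smul, Real.norm_of_nonneg (by positivity), one_div, inv_mul_eq_div]
        exact div_le_div₀ hδ hd hB.tmin_pos (hs.tmin_le.trans hs.tlow_le)
  · convert hT.x_opt using 1
    rw [map_sub, map_sub, sub_apply]
    abel

theorem IsTrial.infEDist_le (hP : P.Assumptions) (hB : Bounds P A Lh LF G tmin)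
    (hs : s.Good P A tmin) (hT : IsTrial P s T) {v : ℝ} (hv : predDecrease P s T ≤ v) :
    ∃ y z, Metric.infEDist 0 (P.S T.x y z) ≤ ENNReal.ofReal (residual A Lh LF G tmin v) := by
  obtain ⟨y, z, u, hy, hle, hu⟩ := hT.approx_stationary hP hB hs hv
  refine ⟨y, z, ?_⟩
  -- Since y is an exact subgradient at z, the middle component is 0.
  let w : WithLp 2 (E m × WithLp 2 (E m × E n)) :=
    WithLp.toLp 2 (P.F T.x - z, WithLp.toLp 2 (0, u))
  have hw : w ∈ P.S T.x y z := hP.mem_S rfl (by simpa [w] using hy) hu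
  refine (Metric.infEDist_le_edist_of_mem hw).trans ?_
  rw [edist_dist, dist_zero_left]
  refine ENNReal.ofReal_le_ofReal (le_trans ?_ hle)
  have h2 : ‖w.snd‖ = ‖u‖ := by
    rw [WithLp.prod_norm_eq_of_L2]
    simp [w]
  rw [WithLp.prod_norm_eq_of_L2, h2]
  refine Real.sqrt_le_iff.2 ⟨by positivity, ?_⟩
  have h3 : ‖w.fst‖ = ‖P.F T.x - z‖ := rfl
  rw [h3]
  nlinarith [norm_nonneg (P.F T.x - z), norm_nonneg u]

theorem IsTrial.stationary_of_nonpos (hP : P.Assumptions) (hB : Bounds P A Lh LF G tmin)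
    (hs : s.Good P A tmin) (hT : IsTrial P s T) (hv : predDecrease P s T ≤ 0) :
    T.x = s.center ∧ ∃ y, 0 ∈ P.S s.center y (P.F s.center) := by
  have ht := hs.t_pos hB
  have h1 := hT.le_predDecrease hP ht hs.center_mem
  have h2 := hT.linearization_gap_nonneg hs.lower
  have hx : T.x = s.center := by
    by_contra hne
    have : 0 < ‖T.x - s.center‖ := norm_pos_iff.2 (sub_ne_zero.2 hne)
    have : 0 < 1 / s.t * ‖T.x - s.center‖ ^ 2 := by positivity
    linarith
  refine ⟨hx, T.y, hP.zero_mem_S (fun w => ?_) ?_⟩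
  · have h3 := hT.approx_subgradient hs.lower w
    have h4 : 0 ≤ 1 / s.t * ‖T.x - s.center‖ ^ 2 := by positivity
    linarith
  · have := hT.x_opt
    rw [hx] at this
    simpa using this

/-- Limits of approximately stationary points are stationary. -/
theorem stationary_of_tendsto (hP : P.Assumptions) (hB : Bounds P A Lh LF G tmin)
    {x u : ℕ → E n} {y z : ℕ → E m} {x₀ : E n} {a : ℕ → ℝ} (ha : Tendsto a atTop (𝓝 0))
    (hx : Tendsto x atTop (𝓝 x₀)) (hy : ∀ k, y k ∈ subdiff P.h (z k))
    (hle : ∀ k, ‖P.F (x k) - z k‖ + ‖u k‖ ≤ a k)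
    (hu : ∀ k, u k - gradient P.f₀ (x k) - ContinuousLinearMap.adjoint (fderiv ℝ P.F (x k)) (y k)
      ∈ normalCone P.X (x k)) : ∃ y₀, 0 ∈ P.S x₀ y₀ (P.F x₀) := by
  have hul : Tendsto u atTop (𝓝 0) :=
    squeeze_zero_norm (fun k => by linarith [hle k, norm_nonneg (P.F (x k) - z k)]) ha
  have hzl' : Tendsto (fun k => P.F (x k) - z k) atTop (𝓝 0) :=
    squeeze_zero_norm (fun k => by linarith [hle k, norm_nonneg (u k)]) ha
  have hzl : Tendsto z atTop (𝓝 (P.F x₀)) := by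
    have := ((hP.contDiff_F.continuous.tendsto x₀).comp hx).sub hzl'
    rw [sub_zero] at this
    exact this.congr fun k => by simp
  obtain ⟨y₀, -, φ, hφ, hyl⟩ := (isCompact_closedBall (0 : E m) Lh).tendsto_subseq (x := y)
    (fun k => by simpa using norm_le_of_mem_subdiff hB.Lh_pos.le hB.h_sub_le (hy k))
  have hφ' := hφ.tendsto_atTop
  refine ⟨y₀, hP.zero_mem_S (mem_subdiff_of_tendsto hP.continuous_h hyl (hzl.comp hφ')
    fun k => hy _) ?_⟩
  rw [← zero_sub (gradient P.f₀ x₀)]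
  refine mem_normalCone_of_tendsto hP.closed_X ?_ (hx.comp hφ') fun k => hu (φ k)
  have hxl := hx.comp hφ'
  refine ((hul.comp hφ').sub (((continuous_gradient hP.smooth_f₀).tendsto _).comp hxl)).sub ?_
  simp only [hP.adjoint_fderiv_F]
  refine tendsto_finsetSum _ fun i _ => Tendsto.smul ?_
    (((continuous_gradient (hP.smooth_F i)).tendsto _).comp hxl)
  exact ((EuclideanSpace.proj (𝕜 := ℝ) i).continuous.tendsto y₀).comp hyl

end Stationarity

/-! ### Infinite executions: the predicted decrease becomes small. -/

section InfiniteRun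

/-- A sequence that is eventually nonincreasing and bounded below has vanishing decrements. -/
theorem exists_sub_succ_lt {a : ℕ → ℝ} {b : ℝ} {K : ℕ} (ha : ∀ k ≥ K, a (k + 1) ≤ a k)
    (hb : ∀ k ≥ K, b ≤ a k) {c : ℝ} (hc : 0 < c) : ∃ N ≥ K, ∀ k ≥ N, a k - a (k + 1) < c := by
  have hanti : Antitone fun j => a (K + j) := antitone_nat_of_succ_le fun j => ha _ (Nat.le_add_right K j)
  have hlim := tendsto_atTop_ciInf hanti ⟨b, by rintro _ ⟨j, rfl⟩; exact hb _ (Nat.le_add_right K j)⟩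
  have hdiff := hlim.sub (hlim.comp (tendsto_add_atTop_nat 1))
  rw [sub_self] at hdiff
  obtain ⟨N, hN⟩ := eventually_atTop.1 (hdiff.eventually_lt_const hc)
  refine ⟨K + N, by omega, fun k hk => ?_⟩
  have := hN (k - K) (by omega)
  simp only [Function.comp_apply] at this
  rwa [show K + (k - K) = k by omega, show K + (k - K + 1) = k + 1 by omega] at this

/-- An execution that never stops. -/
structure Run.IsInfinite (P : Problem n m) (A : Params n) (r : Run n m) : Prop where
  init : IsInit P A (r.state 0)
  trial : ∀ k, IsTrial P (r.state k) (r.trial k)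
  v_pos : ∀ k, 0 < r.v P k
  update : ∀ k, Update P A (r.state k) (r.trial k) (r.state (k + 1))

variable {r : Run n m}

theorem Run.IsExecution.isInfinite {Tol : ℝ} (hTol : 0 ≤ Tol) (hr : r.IsExecution P A Tol)
    (hv : ∀ k, Tol < r.v P k) : r.IsInfinite P A where
  init := hr.1
  trial k := (hr.2 k fun j _ => hv j).1
  v_pos k := hTol.trans_lt (hv k)
  update k := (hr.2 k fun j _ => hv j).2 (hv k)

namespace Run.IsInfinite

theorem good (hP : P.Assumptions) (hA : A.Valid P) (hB : Bounds P A Lh LF G tmin)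
    (hr : r.IsInfinite P A) (k : ℕ) : (r.state k).Good P A tmin := by
  induction k with
  | zero => exact hr.init.good hA hB
  | succ k ih => exact ih.update hP hA hB (hr.trial k) (hr.update k)

theorem center_succ (hr : r.IsInfinite P A) {k : ℕ}
    (hk : ¬ (Test₁ P A (r.state k) (r.trial k) ∧ Test₂ P A (r.state k) (r.trial k))) :
    r.center (k + 1) = r.center k := by
  by_cases h₁ : Test₁ P A (r.state k) (r.trial k)
  · exact ((hr.update k).2.1 h₁ fun h₂ => hk ⟨h₁, h₂⟩).center_eq
  · exact ((hr.update k).2.2 h₁).center_eq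

theorem center_eq_of_le (hr : r.IsInfinite P A) {N k : ℕ} (hk : N ≤ k)
    (h : ∀ j, N ≤ j → j < k →
      ¬ (Test₁ P A (r.state j) (r.trial j) ∧ Test₂ P A (r.state j) (r.trial j))) :
    r.center k = r.center N := by
  induction k, hk using Nat.le_induction with
  | base => rfl
  | succ k hk ih =>
    rw [hr.center_succ (h k hk k.lt_succ_self),
      ih fun j hj hjk => h j hj (hjk.trans k.lt_succ_self)]

theorem obj_succ_le_of_serious (hr : r.IsInfinite P A) {k : ℕ}
    (hk : Test₁ P A (r.state k) (r.trial k) ∧ Test₂ P A (r.state k) (r.trial k)) :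
    P.obj (r.center (k + 1)) ≤ P.obj (r.center k) - A.κ / 2 * r.v P k := by
  have h : r.center (k + 1) = (r.trial k).x := ((hr.update k).1 hk.1 hk.2).center_eq
  rw [h]
  exact hk.2

/-- With infinitely many serious steps, the predicted decrease at the next serious step vanishes. -/
theorem exists_small_of_frequently_serious (hP : P.Assumptions) (hA : A.Valid P)
    (hlev : P.LevelBounded A.x₀) (hB : Bounds P A Lh LF G tmin) (hr : r.IsInfinite P A)
    (hser : ∀ N, ∃ k ≥ N, Test₁ P A (r.state k) (r.trial k) ∧ Test₂ P A (r.state k) (r.trial k))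
    {c : ℝ} (hc : 0 < c) :
    ∃ N₀, ∀ N ≥ N₀, ∃ k ≥ N, r.center k = r.center N ∧ r.v P k < c := by
  obtain ⟨b, hb⟩ := (hP.isCompact_level hlev).bddBelow_image hP.continuous_obj.continuousOn
  have hκ := hA.κ_pos
  obtain ⟨N₀, -, hN₀⟩ := exists_sub_succ_lt (a := fun k => P.obj (r.center k)) (b := b) (K := 0)
    (fun k _ => by
      by_cases hk : Test₁ P A (r.state k) (r.trial k) ∧ Test₂ P A (r.state k) (r.trial k)
      · have := hr.obj_succ_le_of_serious hk
        nlinarith [hr.v_pos k]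
      · exact (congrArg P.obj (hr.center_succ hk)).le)
    (fun k _ => hb ⟨_, ⟨(hr.good hP hA hB k).center_mem, (hr.good hP hA hB k).obj_le⟩, rfl⟩)
    (c := A.κ / 2 * c) (by positivity)
  refine ⟨N₀, fun N hN => ?_⟩
  classical
  -- The first serious step from N on: the center has not moved since N.
  obtain ⟨hk, hs⟩ := Nat.find_spec (hser N)
  have hmin : ∀ j, N ≤ j → j < Nat.find (hser N) →
      ¬ (Test₁ P A (r.state j) (r.trial j) ∧ Test₂ P A (r.state j) (r.trial j)) :=
    fun j hj hjk h => Nat.find_min (hser N) hjk ⟨hj, h⟩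
  refine ⟨_, hk, hr.center_eq_of_le hk hmin, ?_⟩
  have h1 := hN₀ _ (hN.trans hk)
  have h2 := hr.obj_succ_le_of_serious hs
  have h3 : A.κ / 2 * r.v P (Nat.find (hser N)) < A.κ / 2 * c := by linarith
  exact lt_of_mul_lt_mul_left h3 (by positivity)

/-- Without serious steps, there are only finitely many backtracking steps. -/
theorem exists_forall_null (hP : P.Assumptions) (hA : A.Valid P)
    (hB : Bounds P A Lh LF G tmin) (hr : r.IsInfinite P A) {K : ℕ}
    (hK : ∀ k ≥ K, ¬ (Test₁ P A (r.state k) (r.trial k) ∧ Test₂ P A (r.state k) (r.trial k))) :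
    ∃ N ≥ K, ∀ k ≥ N, ¬ Test₁ P A (r.state k) (r.trial k) := by
  have hτ := hA.one_lt_τ
  have hτ0 : 0 < A.τ := one_pos.trans hτ
  have hinv : A.τ⁻¹ < 1 := inv_lt_one_of_one_lt₀ hτ
  have hback : ∀ k ≥ K, Test₁ P A (r.state k) (r.trial k) →
      (r.state (k + 1)).t = (r.state k).t * A.τ⁻¹ := fun k hk h₁ =>
    ((hr.update k).2.1 h₁ fun h₂ => hK k hk ⟨h₁, h₂⟩).t_eq
  have hge : ∀ k, tmin ≤ (r.state k).t := fun k =>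
    (hr.good hP hA hB k).tmin_le.trans (hr.good hP hA hB k).tlow_le
  have ht0 := hB.tmin_pos
  obtain ⟨N, hNK, hN⟩ := exists_sub_succ_lt (a := fun k => (r.state k).t) (b := tmin) (K := K)
    (fun k hk => by
      by_cases h₁ : Test₁ P A (r.state k) (r.trial k)
      · rw [hback k hk h₁]
        exact mul_le_of_le_one_right (ht0.le.trans (hge k)) hinv.le
      · exact ((hr.update k).2.2 h₁).t_mem.2)
    -- A backtracking step lowers t by at least this amount, because t ≥ `tmin`.
    (fun k _ => hge k) (c := tmin * (1 - A.τ⁻¹)) (mul_pos ht0 (by linarith))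
  refine ⟨N, hNK, fun k hk h₁ => ?_⟩
  have h1 := hN k hk
  rw [hback k (hNK.trans hk) h₁] at h1
  have h2 := mul_le_mul_of_nonneg_right (hge k) (by linarith : 0 ≤ 1 - A.τ⁻¹)
  linarith

/-- The optimal value of the master problem in iteration `k`. -/
noncomputable def masterValue (P : Problem n m) (r : Run n m) (k : ℕ) : ℝ :=
  P.f₀ (r.trial k).x + (r.state k).model (r.trial k).z
    + 1 / (2 * (r.state k).t) * ‖(r.trial k).x - r.center k‖ ^ 2

theorem masterValue_add_le_obj (hP : P.Assumptions) (hA : A.Valid P)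
    (hB : Bounds P A Lh LF G tmin) (hr : r.IsInfinite P A) (k : ℕ) :
    masterValue P r k + 1 / (2 * (r.state k).t) * ‖(r.trial k).x - r.center k‖ ^ 2
      ≤ P.obj (r.center k) := by
  have hg := hr.good hP hA hB k
  have h1 := (hr.trial k).growth hP (hg.t_pos hB) hg.center_mem
  rw [sub_self, map_zero, add_zero, norm_zero, norm_sub_rev (r.state k).center] at h1
  have h2 := (hr.trial k).linearization_gap_nonneg hg.lower
  unfold masterValue Problem.obj Run.center
  linarith

/-- Growth holds already for the model's linearization at the old trial point, and the new model
lies above that linearization. As t does not increase, the prox term can only grow. -/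
theorem masterValue_add_le_succ (hP : P.Assumptions) (hA : A.Valid P)
    (hB : Bounds P A Lh LF G tmin) (hr : r.IsInfinite P A) {k : ℕ}
    (hk : ¬ Test₁ P A (r.state k) (r.trial k)) :
    masterValue P r k + 1 / (2 * A.tmax) * ‖(r.trial (k + 1)).x - (r.trial k).x‖ ^ 2
      ≤ masterValue P r (k + 1) := by
  have hg := hr.good hP hA hB k
  have hg' := hr.good hP hA hB (k + 1)
  have ht := hg.t_pos hB
  have ht' := hg'.t_pos hB
  have hN := (hr.update k).2.2 hk
  have h1 := (hr.trial k).growth hP ht (hr.trial (k + 1)).x_opt.1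
  have hz := (hr.trial (k + 1)).z_eq
  rw [hN.center_eq] at hz
  rw [← hz] at h1
  have h2 := hN.model.2.2.2 (r.trial (k + 1)).z
  have h3 : 1 / (2 * (r.state k).t) ≤ 1 / (2 * (r.state (k + 1)).t) :=
    one_div_le_one_div_of_le (by positivity) (by linarith [hN.t_mem.2])
  have h4 : 1 / (2 * A.tmax) ≤ 1 / (2 * (r.state k).t) :=
    one_div_le_one_div_of_le (by positivity) (by linarith [hg.t_le])
  have h5 := mul_le_mul_of_nonneg_right h3
    (sq_nonneg ‖(r.trial (k + 1)).x - (r.state k).center‖)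
  have h6 := mul_le_mul_of_nonneg_right h4 (sq_nonneg ‖(r.trial (k + 1)).x - (r.trial k).x‖)
  unfold masterValue Run.center
  rw [hN.center_eq]
  linarith

/-- The new model lies above a cut of h at the old z, so it can undershoot h there only in
proportion to the distance of the trial points. Failure of the first test bounds the remaining
decrease by κv. -/
theorem v_succ_le (hP : P.Assumptions) (hA : A.Valid P)
    (hB : Bounds P A Lh LF G tmin) (hr : r.IsInfinite P A) {k : ℕ}
    (hk : ¬ Test₁ P A (r.state k) (r.trial k)) {M : ℝ}
    (hM : ‖gradient P.f₀ (r.trial k).x‖ ≤ M) :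
    r.v P (k + 1) ≤ A.κ * r.v P k + (M + Lh * G) * ‖(r.trial (k + 1)).x - (r.trial k).x‖ := by
  have hg := hr.good hP hA hB k
  have hN := (hr.update k).2.2 hk
  obtain ⟨g, hg1, hg2⟩ := hN.model.2.2.1
  have h1 := hg2 (r.trial (k + 1)).z
  have hgL := norm_le_of_mem_subdiff hB.Lh_pos.le hB.h_sub_le hg1
  have hz : (r.trial (k + 1)).z - (r.trial k).z
      = fderiv ℝ P.F (r.state k).center ((r.trial (k + 1)).x - (r.trial k).x) := by
    rw [(hr.trial (k + 1)).z_eq, (hr.trial k).z_eq, hN.center_eq, add_sub_add_left_eq_sub,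
      ← map_sub, sub_sub_sub_cancel_right]
  have h2 : -inner ℝ g ((r.trial (k + 1)).z - (r.trial k).z)
      ≤ Lh * G * ‖(r.trial (k + 1)).x - (r.trial k).x‖ := by
    refine (neg_le_abs _).trans ((abs_real_inner_le_norm _ _).trans ?_)
    rw [mul_assoc, hz]
    refine mul_le_mul hgL ((ContinuousLinearMap.le_opNorm _ _).trans ?_) (norm_nonneg _)
      hB.Lh_pos.le
    exact mul_le_mul_of_nonneg_right (hB.fderiv_le _ hg.center_mem hg.obj_le) (norm_nonneg _)
  have h3 := gradient_mem_subdiff hP.differentiable_f₀ hP.convex_f₀ (r.trial k).x (r.trial (k + 1)).x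
  have h4 : -inner ℝ (gradient P.f₀ (r.trial k).x) ((r.trial (k + 1)).x - (r.trial k).x)
      ≤ M * ‖(r.trial (k + 1)).x - (r.trial k).x‖ :=
    (neg_le_abs _).trans ((abs_real_inner_le_norm _ _).trans
      (mul_le_mul_of_nonneg_right hM (norm_nonneg _)))
  unfold Test₁ at hk
  unfold Run.v
  unfold predDecrease at hk ⊢
  rw [hN.center_eq]
  linarith

/-- In an infinite sequence of null steps the predicted decrease gets arbitrarily small. -/
theorem exists_small_of_forall_null (hP : P.Assumptions) (hA : A.Valid P)
    (hB : Bounds P A Lh LF G tmin) (hr : r.IsInfinite P A) {K : ℕ}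
    (hK : ∀ k ≥ K, ¬ Test₁ P A (r.state k) (r.trial k)) {c : ℝ} (hc : 0 < c) :
    ∃ N₀, ∀ N ≥ N₀, ∃ k ≥ N, r.center k = r.center N ∧ r.v P k < c := by
  have hcen : ∀ k ≥ K, r.center k = r.center K := fun k hk =>
    hr.center_eq_of_le hk fun j hj _ h => hK j hj h.1
  have htmax : 0 < A.tmax := (hr.good hP hA hB 0).t_pos hB |>.trans_le (hr.good hP hA hB 0).t_le
  have hstep : ∀ k ≥ K, masterValue P r k
      + 1 / (2 * A.tmax) * ‖(r.trial (k + 1)).x - (r.trial k).x‖ ^ 2 ≤ masterValue P r (k + 1) :=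
    fun k hk => hr.masterValue_add_le_succ hP hA hB (hK k hk)
  have hmono : ∀ k ≥ K, masterValue P r k ≤ masterValue P r (k + 1) := fun k hk =>
    le_trans (le_add_of_nonneg_right (by positivity)) (hstep k hk)
  have hobj : ∀ k ≥ K, masterValue P r k
      + 1 / (2 * A.tmax) * ‖(r.trial k).x - r.center K‖ ^ 2 ≤ P.obj (r.center K) := by
    intro k hk
    have h1 := hr.masterValue_add_le_obj hP hA hB k
    have hg := hr.good hP hA hB k
    have ht := hg.t_pos hB
    rw [hcen k hk] at h1
    have h2 : 1 / (2 * A.tmax) ≤ 1 / (2 * (r.state k).t) :=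
      one_div_le_one_div_of_le (by positivity) (by linarith [hg.t_le])
    have h3 := mul_le_mul_of_nonneg_right h2 (sq_nonneg ‖(r.trial k).x - r.center K‖)
    linarith
  have hbase : ∀ k ≥ K, masterValue P r K ≤ masterValue P r k := fun k hk => by
    induction k, hk using Nat.le_induction with
    | base => exact le_rfl
    | succ k hk ih => exact ih.trans (hmono k hk)
  -- Master values stay above their value at K, so the quadratic term in `hobj` confines all later
  -- trial points to this ball, on which the gradient of f₀ is bounded.
  set R := √(2 * A.tmax * (P.obj (r.center K) - masterValue P r K)) with hR
  have hball : ∀ k ≥ K, (r.trial k).x ∈ Metric.closedBall (r.center K) R := by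
    intro k hk
    rw [Metric.mem_closedBall, dist_eq_norm, hR]
    refine Real.le_sqrt_of_sq_le ?_
    have h1 : 1 / (2 * A.tmax) * ‖(r.trial k).x - r.center K‖ ^ 2
        ≤ P.obj (r.center K) - masterValue P r K := by linarith [hobj k hk, hbase k hk]
    rwa [one_div, inv_mul_le_iff₀ (by positivity)] at h1
  obtain ⟨M, hM⟩ := (isCompact_closedBall (r.center K) R).exists_bound_of_continuousOn
    (continuous_gradient hP.smooth_f₀).continuousOn
  have hM0 : 0 ≤ M := (norm_nonneg _).trans (hM _ (hball K le_rfl))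
  have hκ : 0 < 1 - A.κ := sub_pos.2 hA.κ_lt
  have hC : 0 < M + Lh * G + 1 := by
    have := mul_nonneg hB.Lh_pos.le hB.G_nonneg
    linarith
  -- Chosen so that (M + Lh·G + 1)·η = (1 - κ)c/2. Then, as long as v ≥ c, each step lowers v by at
  -- least (1 - κ)c/2, which cannot go on forever.
  set η := (1 - A.κ) * c / (2 * (M + Lh * G + 1)) with hη
  have hη0 : 0 < η := by positivity
  obtain ⟨N₀, hN₀K, hN₀⟩ := exists_sub_succ_lt (a := fun k => -masterValue P r k)
    (b := -P.obj (r.center K)) (K := K) (fun k hk => neg_le_neg (hmono k hk))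
    (fun k hk => neg_le_neg (le_trans (le_add_of_nonneg_right (by positivity)) (hobj k hk)))
    (c := 1 / (2 * A.tmax) * η ^ 2) (by positivity)
  have hdec : ∀ k ≥ N₀, r.v P (k + 1) ≤ A.κ * r.v P k + (1 - A.κ) * c / 2 := by
    intro k hk
    have h1 := hstep k (hN₀K.trans hk)
    have h2 := hN₀ k hk
    have h3 : 1 / (2 * A.tmax) * ‖(r.trial (k + 1)).x - (r.trial k).x‖ ^ 2
      < 1 / (2 * A.tmax) * η ^ 2 := by linarith
    have h4 := lt_of_mul_lt_mul_left h3 (by positivity)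
    have h5 : ‖(r.trial (k + 1)).x - (r.trial k).x‖ ≤ η := (lt_of_pow_lt_pow_left₀ 2 hη0.le h4).le
    have h6 := hr.v_succ_le hP hA hB (hK k (hN₀K.trans hk)) (hM _ (hball k (hN₀K.trans hk)))
    have h7 : (M + Lh * G) * ‖(r.trial (k + 1)).x - (r.trial k).x‖ ≤ (M + Lh * G + 1) * η :=
      mul_le_mul (by linarith) h5 (norm_nonneg _) hC.le
    have h8 : (M + Lh * G + 1) * η = (1 - A.κ) * c / 2 := by
      rw [hη]; field_simp
    linarith
  refine ⟨N₀, fun N hN => ?_⟩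
  by_contra! hcon
  have hcN : ∀ k ≥ N, c ≤ r.v P k := fun k hk =>
    hcon k hk ((hcen k (hN₀K.trans (hN.trans hk))).trans (hcen N (hN₀K.trans hN)).symm)
  have hgap : ∀ k ≥ N, (1 - A.κ) * c / 2 ≤ r.v P k - r.v P (k + 1) := by
    intro k hk
    have h1 := hdec k (hN.trans hk)
    have h2 := mul_le_mul_of_nonneg_left (hcN k hk) hκ.le
    linarith
  have hpos : 0 < (1 - A.κ) * c / 2 := by positivity
  obtain ⟨N₁, hN₁, h⟩ := exists_sub_succ_lt (a := fun k => r.v P k) (b := c) (K := N)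
    (fun k hk => by linarith [hgap k hk]) hcN hpos
  linarith [h N₁ le_rfl, hgap N₁ hN₁]

/-- The clause on equal centers serves the cluster points: an iterate close to a cluster point may
itself have a large v, but a later iteration with the same center has a small one. -/
theorem exists_small (hP : P.Assumptions) (hA : A.Valid P) (hlev : P.LevelBounded A.x₀)
    (hB : Bounds P A Lh LF G tmin) (hr : r.IsInfinite P A) {c : ℝ} (hc : 0 < c) :
    ∃ N₀, ∀ N ≥ N₀, ∃ k ≥ N, r.center k = r.center N ∧ r.v P k < c := by
  by_cases hser : ∀ N, ∃ k ≥ N,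
      Test₁ P A (r.state k) (r.trial k) ∧ Test₂ P A (r.state k) (r.trial k)
  · exact hr.exists_small_of_frequently_serious hP hA hlev hB hser hc
  · push Not at hser
    obtain ⟨K, hK⟩ := hser
    obtain ⟨N, -, hN⟩ := hr.exists_forall_null hP hA hB (K := K) fun k hk h => hK k hk h.1 h.2
    exact hr.exists_small_of_forall_null hP hA hB hN hc

theorem liminf_v (hP : P.Assumptions) (hA : A.Valid P) (hlev : P.LevelBounded A.x₀)
    (hB : Bounds P A Lh LF G tmin) (hr : r.IsInfinite P A) :
    liminf (fun k => ((r.v P k : ℝ) : EReal)) atTop = 0 := by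
  refine le_antisymm (le_of_forall_gt_imp_ge_of_dense fun b hb => ?_) ?_
  · obtain ⟨c, hc0, hcb⟩ := EReal.lt_iff_exists_real_btwn.1 hb
    have hc : 0 < c := by exact_mod_cast hc0
    obtain ⟨N₀, hN₀⟩ := hr.exists_small hP hA hlev hB hc
    refine (liminf_le_of_frequently_le' (x := (c : EReal)) ?_).trans hcb.le
    refine frequently_atTop.2 fun N => ?_
    obtain ⟨k, hk, -, hv⟩ := hN₀ (max N N₀) (le_max_right _ _)
    exact ⟨k, (le_max_left _ _).trans hk, by exact_mod_cast hv.le⟩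
  · exact le_liminf_of_le (by isBoundedDefault)
      (Eventually.of_forall fun k => by exact_mod_cast (hr.v_pos k).le)

theorem stationary_of_mapClusterPt (hP : P.Assumptions) (hA : A.Valid P)
    (hlev : P.LevelBounded A.x₀) (hB : Bounds P A Lh LF G tmin) (hr : r.IsInfinite P A) {x : E n}
    (hx : MapClusterPt x atTop r.center) : ∃ y, 0 ∈ P.S x y (P.F x) := by
  have hj : ∀ j : ℕ, ∃ k, ‖r.center k - x‖ < 1 / ((j : ℝ) + 1) ∧ r.v P k < 1 / ((j : ℝ) + 1) := by
    intro j
    have hpos : (0 : ℝ) < 1 / ((j : ℝ) + 1) := Nat.one_div_pos_of_nat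
    obtain ⟨N₀, hN₀⟩ := hr.exists_small hP hA hlev hB hpos
    obtain ⟨N, hN, hxN⟩ := frequently_atTop.1
      (mapClusterPt_iff_frequently.1 hx _ (Metric.ball_mem_nhds x hpos)) N₀
    obtain ⟨k, -, hk, hv⟩ := hN₀ N hN
    exact ⟨k, by rw [hk, ← dist_eq_norm]; exact hxN, hv⟩
  choose k hk hv using hj
  choose y z u hy hle hu using fun j => (hr.trial (k j)).approx_stationary hP hB
    (hr.good hP hA hB (k j)) (hv j).le
  have hinv : Tendsto (fun j : ℕ => 1 / ((j : ℝ) + 1)) atTop (𝓝 0) :=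
    tendsto_one_div_add_atTop_nhds_zero_nat
  have hres : Tendsto (fun j : ℕ => residual A Lh LF G tmin (1 / ((j : ℝ) + 1))) atTop (𝓝 0) := by
    have := ((continuous_residual A Lh LF G tmin).tendsto 0).comp hinv
    rwa [residual_zero] at this
  have hcen : Tendsto (fun j => r.center (k j)) atTop (𝓝 x) :=
    tendsto_iff_norm_sub_tendsto_zero.2
      (squeeze_zero (fun _ => norm_nonneg _) (fun j => (hk j).le) hinv)
  have hdist : Tendsto (fun j => (r.trial (k j)).x - r.center (k j)) atTop (𝓝 0) := by
    have hsq : Tendsto (fun j : ℕ => √(A.tmax * (1 / ((j : ℝ) + 1)))) atTop (𝓝 0) := by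
      simpa using (hinv.const_mul A.tmax).sqrt
    refine squeeze_zero_norm (fun j => Real.le_sqrt_of_sq_le ?_) hsq
    have hg := hr.good hP hA hB (k j)
    have ht := hg.t_pos hB
    have h1 := ((hr.trial (k j)).norm_sq_le hP ht hg.center_mem hg.lower).trans (hv j).le
    rw [one_div (r.state (k j)).t, inv_mul_le_iff₀ ht] at h1
    exact h1.trans (mul_le_mul_of_nonneg_right hg.t_le (by positivity))
  have hxl : Tendsto (fun j => (r.trial (k j)).x) atTop (𝓝 x) := by
    have := hcen.add hdist
    rw [add_zero] at this
    exact this.congr fun j => by abel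
  exact stationary_of_tendsto hP hB hres hxl hy hle hu

end Run.IsInfinite

end InfiniteRun

/-! ### Assembly of the theorem. -/

/-- An execution either never stops or stops in a first iteration. -/
theorem Run.exists_stopsAt {r : Run n m} {Tol : ℝ} (h : ¬ ∀ k, Tol < r.v P k) :
    ∃ k, r.StopsAt P Tol k := by
  classical
  push Not at h
  exact ⟨Nat.find h, fun j hj => not_le.1 (Nat.find_min h hj), Nat.find_spec h⟩

end CompositeBundle

theorem mainTheorem2 {n m : ℕ} (P : CompositeBundle.Problem n m) (hP : P.Assumptions)
    (A : CompositeBundle.Params n) (hA : A.Valid P) (hlev : P.LevelBounded A.x₀) :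
    (∀ Tol : ℝ, 0 ≤ Tol → CompositeBundle.WellDefined P A Tol) ∧
    (∀ r : CompositeBundle.Run n m, r.IsExecution P A 0 →
      (∃ k, r.StopsAt P 0 k ∧ r.next k = r.center k ∧
        ∃ y, 0 ∈ P.S (r.center k) y (P.F (r.center k))) ∨
      ((∀ k, 0 < r.v P k) ∧
        (r.BoundedSubgradients P 0 →
          Filter.liminf (fun k => ((r.v P k : ℝ) : EReal)) Filter.atTop = 0 ∧
          ∀ x : CompositeBundle.E n, MapClusterPt x Filter.atTop r.center →
            ∃ y, 0 ∈ P.S x y (P.F x)))) ∧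
    (∃ ε : ℝ → ℝ, (∀ Tol, 0 < Tol → 0 ≤ ε Tol) ∧
      Filter.Tendsto ε (nhdsWithin 0 (Set.Ioi 0)) (nhds 0) ∧
      ∀ Tol : ℝ, 0 < Tol → ∀ r : CompositeBundle.Run n m, r.IsExecution P A Tol →
        ∃ k, r.StopsAt P Tol k ∧
          ∃ y z, Metric.infEDist 0 (P.S (r.next k) y z) ≤ ENNReal.ofReal (ε Tol)) := by
  obtain ⟨Lh, LF, G, tmin, hB⟩ := CompositeBundle.exists_bounds hP hA hlev
  have hgood : ∀ {Tol : ℝ} {r : CompositeBundle.Run n m}, r.IsExecution P A Tol → ∀ {k : ℕ},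
      r.StopsAt P Tol k → (r.state k).Good P A tmin ∧
        CompositeBundle.IsTrial P (r.state k) (r.trial k) := fun hr k hk =>
    ⟨CompositeBundle.Run.good_of_active hP hA hB hr.1 (fun j _ => hr.2 j) hk.1, (hr.2 k hk.1).1⟩
  refine ⟨fun Tol _ => CompositeBundle.wellDefined hP hA hB, fun r hr => ?_,
    CompositeBundle.residual A Lh LF G tmin, fun Tol _ => hB.residual_nonneg Tol, ?_,
    fun Tol hTol r hr => ?_⟩
  · by_cases h : ∀ k, 0 < r.v P k
    · have hinf := hr.isInfinite le_rfl h
      exact Or.inr ⟨h, fun _ => ⟨hinf.liminf_v hP hA hlev hB,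
        fun x hx => hinf.stationary_of_mapClusterPt hP hA hlev hB hx⟩⟩
    · obtain ⟨k, hk⟩ := CompositeBundle.Run.exists_stopsAt h
      obtain ⟨hg, hT⟩ := hgood hr hk
      exact Or.inl ⟨k, hk, hT.stationary_of_nonpos hP hB hg hk.2⟩
  · have h := (CompositeBundle.continuous_residual A Lh LF G tmin).tendsto 0
    rw [CompositeBundle.residual_zero] at h
    exact h.mono_left nhdsWithin_le_nhds
  -- An execution that never stops would still have some v below Tol.
  · have hterm : ¬ ∀ k, Tol < r.v P k := fun h => by
      obtain ⟨N, hN⟩ := (hr.isInfinite hTol.le h).exists_small hP hA hlev hB hTol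
      obtain ⟨k, -, -, hv⟩ := hN N le_rfl
      exact lt_asymm hv (h k)
    obtain ⟨k, hk⟩ := CompositeBundle.Run.exists_stopsAt hterm
    obtain ⟨hg, hT⟩ := hgood hr hk
    exact ⟨k, hk, hT.infEDist_le hP hB hg hk.2⟩
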